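/- **Setting.** Let $\mathcal G$ be a finite directed graph with distinguished input node $\iota$ and output node $o\neq\iota$, and assume that $\mathcal G$ is a core network: every node is downstream from $\iota$ and upstream from $o$. An $\iota o$-simple path is a directed path from $\iota$ to $o$ without repeated nodes. A node is *simple* if it lies on some $\iota o$-simple path, *appendage* otherwise, and *super-simple* if it lies on every $\iota o$-simple path. Write $\iota=\rho_0\prec\rho_1\prec\dots\prec\rho_{q+1}=o$ for the super-simple nodes in the order in which they occur on $\iota o$-simple paths; for simple nodes, $\sigma_1\prec\sigma_2$ means that some $\iota o$-simple path visits $\sigma_1$ before $\sigma_2$ with a super-simple node weakly between them (possibly $\sigma_1$ or $\sigma_2$ itself). For an $\iota o$-simple path $S$ let $C_S$ be the subnetwork of the nodes not on $S$. An appendage node $\tau$ is *super-appendage* if for every $S$ the strong component of $\tau$ in $C_S$ consists of appendage nodes only. For $1\le j\le q+1$ let $\mathcal L_j''$ be the set of simple nodes $\sigma$ with $\rho_{j-1}\prec\sigma\prec\rho_j$; let $T_j$ be the set of appendage, not super-appendage nodes $\tau$ whose strong component in some $C_S$ contains a node of $\mathcal L_j''$ and consists of $\tau$, nodes of $\mathcal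 L_j''$, and appendage nodes that are not super-appendage; and let $\mathcal L_j'=\mathcal L_j''\cup T_j$ and $\mathcal L_j=\{\rho_{j-1}\}\cup\mathcal L_j'\cup\{\rho_j\}$ (the $j$-th structural subnetwork). The *structural pattern network* $\mathcal P_{\mathcal S}$ is the feedforward network $$\rho_0\to\tilde{\mathcal L}_1\to\rho_1\to\tilde{\mathcal L}_2\to\cdots\to\tilde{\mathcal L}_{q+1}\to\rho_{q+1},$$ where the backbone node $\tilde{\mathcal L}_j$ stands for $\mathcal L_j'$ (and is present even if $\mathcal L_j'=\emptyset$). An *admissible family* is a $C^\infty$ family $\dot X=f(X,\mathcal I)$, $X=(x_\kappa)_{\kappa\in\mathcal G}$, $\mathcal I\in\mathbb R$, in which $\mathcal I$ appears only in the equation of $\iota$, and $f_{k,\ell}=\partial f_k/\partial x_\ell$ vanishes identically precisely when $\ell\ne k$ and there is no arrow $\ell\to k$. At a hyperbolic equilibrium $X_0$ for $\mathcal I=\mathcal I_0$, a node $\kappa$ is *homeostatic* if $x_\kappa'(\mathcal I_0)=0$ along the smooth family $X(\mathcal I)$ of equilibria with $X(\mathcal I_0)=X_0$. The structural subnetwork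 $\mathcal L_j$ is *homeostasis inducing* at $(X_0,\mathcal I_0)$ if its homeostasis block $B_j=(f_{k,\ell})_{k\in\mathcal L_j\setminus\{\rho_{j-1}\},\ \ell\in\mathcal L_j\setminus\{\rho_j\}}$ satisfies $\det B_j=0$ at $(X_0,\mathcal I_0)$. It *induces* a node $\kappa$ of $\mathcal G$, written $\mathcal L_j\Rightarrow\kappa$, if for generic admissible $f$ (a residual set in the topology of locally uniform convergence of all derivatives), $\kappa$ is homeostatic at every hyperbolic equilibrium $(X_0,\mathcal I_0)$ at which $o$ is homeostatic and $\mathcal L_j$ is homeostasis inducing. In $\mathcal P_{\mathcal S}$, $\tilde{\mathcal L}_j$ *induces* the super-simple node $\rho_i$ if $\mathcal L_j\Rightarrow\rho_i$, and induces the backbone node $\tilde{\mathcal L}_i$ if $\mathcal L_j\Rightarrow\kappa$ for every node $\kappa$ of $\mathcal L_i$. **Theorem.** Let $\tilde{\mathcal L}_j$ be a backbone node of $\mathcal P_{\mathcal S}$. Then $\tilde{\mathcal L}_j$ induces every node of $\mathcal P_{\mathcal S}$ strictly downstream from $\tilde{\mathcal L}_j$ (that is, $\rho_i$ for $i\ge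 j$ and $\tilde{\mathcal L}_i$ for $i>j$), and no other node of $\mathcal P_{\mathcal S}$. -/

import Mathlib

open Filter Topology Matrix
open scoped ContDiff

/-- An input-output network: a directed graph with an input node and an output node, which are
different nodes.  (A loop at a node plays no role: every node is coupled to itself, see
`IONetwork.IsAdmissible`.) -/
structure IONetwork (V : Type*) where
  graph : Digraph V
  input : V
  output : V
  input_ne_output : input ≠ output

namespace IONetwork

section Combinatorics

variable {V : Type*} (G : IONetwork V)

/-- Core network: every node is downstream from the input and upstream from the output. -/
def IsCore : Prop :=
  ∀ v, Relation.ReflTransGen G.graph.Adj G.input v ∧ Relation.ReflTransGen G.graph.Adj v G.output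

/-- `S` is the list of nodes of a simple path from the input node to the output node. -/
def IsIOPath (S : List V) : Prop :=
  S.head? = some G.input ∧ S.getLast? = some G.output ∧ S.Nodup ∧ S.IsChain G.graph.Adj

def IsSimple (v : V) : Prop := ∃ S, G.IsIOPath S ∧ v ∈ S

def IsAppendage (v : V) : Prop := ¬ G.IsSimple v

def IsSuperSimple (v : V) : Prop := G.IsSimple v ∧ ∀ S, G.IsIOPath S → v ∈ S

/-- `a ≺ b`: on some simple path from input to output, `a` appears before `b`
(`[a, b]` is a sublist of the path) and some super-simple node lies weakly between them. -/
def Precedes (a b : V) : Prop :=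
  ∃ S, G.IsIOPath S ∧ [a, b].Sublist S ∧
    ∃ ρ, G.IsSuperSimple ρ ∧ (a = ρ ∨ [a, ρ].Sublist S) ∧ (ρ = b ∨ [ρ, b].Sublist S)

/-- Arrows of the complementary subnetwork `C_S`, whose nodes are the nodes not in `S`. -/
def ComplementArrow (S : List V) (a b : V) : Prop := a ∉ S ∧ b ∉ S ∧ G.graph.Adj a b

/-- The transitive (strong) component of `τ` in the complementary subnetwork `C_S`. -/
def complementComponent (S : List V) (τ : V) : Set V :=
  {v | v ∉ S ∧ Relation.ReflTransGen (G.ComplementArrow S) τ v ∧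
    Relation.ReflTransGen (G.ComplementArrow S) v τ}

def IsSuperAppendage (τ : V) : Prop :=
  G.IsAppendage τ ∧
    ∀ S, G.IsIOPath S → τ ∉ S → ∀ v ∈ G.complementComponent S τ, G.IsAppendage v

/-- Two consecutive super-simple nodes `prev ≺ next`.  These pairs index the structural
subnetworks, and hence the backbone nodes. -/
structure BackboneNode where
  prev : V
  next : V
  prev_superSimple : G.IsSuperSimple prev
  next_superSimple : G.IsSuperSimple next
  prev_precedes_next : G.Precedes prev next
  consecutive : ∀ ρ, G.IsSuperSimple ρ → ¬ (G.Precedes prev ρ ∧ G.Precedes ρ next)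

variable {G}

/-- The simple subnetwork: the simple nodes strictly between the two super-simple nodes. -/
def BackboneNode.simpleSubnetwork (L : G.BackboneNode) : Set V :=
  {σ | G.IsSimple σ ∧ G.Precedes L.prev σ ∧ G.Precedes σ L.next}

/-- The linked appendage nodes: the appendage, not super-appendage nodes `τ` whose transitive
component in some `C_S` contains a node of the simple subnetwork and consists of `τ`, nodes of the
simple subnetwork, and appendage nodes that are not super-appendage. -/
def BackboneNode.linked (L : G.BackboneNode) : Set V :=
  {τ | G.IsAppendage τ ∧ ¬ G.IsSuperAppendage τ ∧ ∃ S, G.IsIOPath S ∧ τ ∉ S ∧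
    (G.complementComponent S τ ∩ L.simpleSubnetwork).Nonempty ∧
    G.complementComponent S τ ⊆
      {τ} ∪ L.simpleSubnetwork ∪ {v | G.IsAppendage v ∧ ¬ G.IsSuperAppendage v}}

/-- The augmented simple subnetwork. -/
def BackboneNode.augmented (L : G.BackboneNode) : Set V := L.simpleSubnetwork ∪ L.linked

/-- The structural subnetwork. -/
def BackboneNode.structural (L : G.BackboneNode) : Set V :=
  {L.prev} ∪ L.augmented ∪ {L.next}

variable (G)

/-- Nodes of the structural pattern network. -/
inductive PatternNode where
  | superSimple (ρ : V) (h : G.IsSuperSimple ρ) : PatternNode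
  | backbone (L : G.BackboneNode) : PatternNode

variable {G} in
/-- Arrows of the structural pattern network: `prev → backbone → next`. -/
inductive PatternArrow : G.PatternNode → G.PatternNode → Prop
  | into (L : G.BackboneNode) :
      PatternArrow (.superSimple L.prev L.prev_superSimple) (.backbone L)
  | out (L : G.BackboneNode) :
      PatternArrow (.backbone L) (.superSimple L.next L.next_superSimple)

/-- The structural pattern network. -/
def structuralPatternNetwork : Digraph G.PatternNode where
  Adj := PatternArrow

/-- `v` is strictly downstream from `u` in the structural pattern network. -/
def StrictlyDownstream (u v : G.PatternNode) : Prop :=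
  Relation.TransGen G.structuralPatternNetwork.Adj u v

end Combinatorics

section Dynamics

variable {V : Type*} [Fintype V] [DecidableEq V]

/-- The matrix of partial derivatives `f_{j,ℓ} = ∂ f_j / ∂ x_ℓ` at the point `p = (X, I)`. -/
noncomputable def jacobian (f : (V → ℝ) × ℝ → (V → ℝ)) (p : (V → ℝ) × ℝ) : Matrix V V ℝ :=
  Matrix.of fun j l => fderiv ℝ f p (Pi.single l 1, 0) j

/-- `Ẋ = f (X, I)` is an admissible family for `G`: `f` is smooth, `f_{j,ℓ}` vanishes identically
precisely when `ℓ ≠ j` and there is no arrow `ℓ → j`, and only the equation of the input node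
contains the input parameter `I`. -/
def IsAdmissible (G : IONetwork V) (f : (V → ℝ) × ℝ → (V → ℝ)) : Prop :=
  ContDiff ℝ ∞ f ∧
  (∀ j l, (∀ p, jacobian f p j l = 0) ↔ ¬ (l = j ∨ G.graph.Adj l j)) ∧
  (∀ j, j ≠ G.input → ∀ X I I', f (X, I) j = f (X, I') j)

/-- The space of admissible families. -/
def AdmissibleFamily (G : IONetwork V) : Type _ := {f : (V → ℝ) × ℝ → (V → ℝ) // G.IsAdmissible f}

variable {G : IONetwork V}

/-- The `n`-th derivative of an admissible family as a continuous map. -/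
noncomputable def AdmissibleFamily.iteratedDerivative (n : ℕ) (f : G.AdmissibleFamily) :
    C((V → ℝ) × ℝ, ((V → ℝ) × ℝ) [×n]→L[ℝ] (V → ℝ)) where
  toFun := iteratedFDeriv ℝ n f.1
  continuous_toFun := f.2.1.continuous_iteratedFDeriv (by exact_mod_cast le_top)

/-- The `C^∞` topology: uniform convergence on compact sets of all derivatives. -/
noncomputable instance : TopologicalSpace G.AdmissibleFamily :=
  ⨅ n : ℕ, TopologicalSpace.induced (AdmissibleFamily.iteratedDerivative n) inferInstance

/-- `X₀` is a hyperbolic equilibrium of `Ẋ = f (X, I₀)`. -/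
def IsHyperbolicEquilibrium (f : (V → ℝ) × ℝ → (V → ℝ)) (X₀ : V → ℝ) (I₀ : ℝ) : Prop :=
  f (X₀, I₀) = 0 ∧
    ∀ z ∈ spectrum ℂ ((jacobian f (X₀, I₀)).map (algebraMap ℝ ℂ)), z.re ≠ 0

/-- The node `κ` is (infinitesimally) homeostatic at `(X₀, I₀)`: the smooth family `X` of equilibria
through `X₀` (which exists and is unique near `I₀` if `X₀` is hyperbolic) has `x_κ'(I₀) = 0`. -/
def IsHomeostatic (f : (V → ℝ) × ℝ → (V → ℝ)) (X₀ : V → ℝ) (I₀ : ℝ) (κ : V) : Prop :=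
  ∃ X : ℝ → V → ℝ, X I₀ = X₀ ∧ ContDiffAt ℝ ∞ X I₀ ∧ (∀ᶠ I in 𝓝 I₀, f (X I, I) = 0) ∧
    deriv (fun I => X I κ) I₀ = 0

/-- The homeostasis matrix of a network with node set `K`, input node `a` and output node `b`, where
`J` is the Jacobian: the rows are the nodes of `K` other than `a`, the columns are the nodes of `K`
other than `b`.  To have a square matrix over one index type, column `a` takes the place of the
missing column `b`; this fixes the order of the columns, hence the sign of the determinant. -/
def homeostasisMatrix (J : Matrix V V ℝ) (K : Set V) (a b : V) :
    Matrix {v // v ∈ K ∧ v ≠ a} {v // v ∈ K ∧ v ≠ a} ℝ :=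
  Matrix.of fun r c => J r (if (c : V) = b then a else c)

open Classical in
/-- The determinant of the homeostasis block of the structural subnetwork of `L`, evaluated at `p`:
the block is the homeostasis matrix of this subnetwork with input `prev` and output `next`. -/
noncomputable def BackboneNode.blockDet (L : G.BackboneNode) (f : (V → ℝ) × ℝ → (V → ℝ))
    (p : (V → ℝ) × ℝ) : ℝ :=
  (homeostasisMatrix (jacobian f p) L.structural L.prev L.next).det

/-- The structural subnetwork of `L` induces homeostasis of the node `κ` of `G`: for generic
admissible `f` (all `f` in a residual subset of the space of admissible families), `κ` is homeostatic
at every hyperbolic equilibrium at which the output node is homeostatic and the structural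
subnetwork is homeostasis inducing. -/
def BackboneNode.InducesNode (L : G.BackboneNode) (κ : V) : Prop :=
  ∀ᶠ f in residual G.AdmissibleFamily, ∀ X₀ I₀, IsHyperbolicEquilibrium f.1 X₀ I₀ →
    IsHomeostatic f.1 X₀ I₀ G.output → L.blockDet f.1 (X₀, I₀) = 0 → IsHomeostatic f.1 X₀ I₀ κ

/-- Induction in the structural pattern network: a super-simple node is induced if it is induced as
a node of `G`; a backbone node is induced if all nodes of its structural subnetwork are. -/
def BackboneNode.Induces (L : G.BackboneNode) : G.PatternNode → Prop
  | .superSimple ρ _ => L.InducesNode ρ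
  | .backbone M => ∀ κ ∈ M.structural, L.InducesNode κ

end Dynamics

end IONetwork

/-!
# Induction in the structural pattern network

The proof rests on the division of the nodes by a super-simple node `b`. Let `before b` be the set
of the nodes reachable from the input without meeting `b`, and `after b` the set of the nodes that
reach the output without meeting `b`. A node in both sets would give a path around `b`, so the
sets are disjoint, and every simple node other than `b` lies in one of them. There is no arrow from
`before b` to a node other than `b` outside of `before b`.

The structural subnetwork of the backbone node `L` between the super-simple nodes `prev` and `next`
consists of these two nodes and of `before next ∩ after prev`
(`IONetwork.BackboneNode.structural_eq`). The hard inclusion concerns an appendage node `a` of this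
intersection. No node separates `prev` from `next` inside it, as such a node would be super-simple;
by the case of two paths of Menger's theorem (`exists_disjoint_paths`) there are two paths from
`prev` to `next` which meet only at their ends. A walk from one of these paths through `a` and back
then forms, with a piece of one of them, a cycle through `a` and a simple node that avoids some
simple path, which makes `a` a linked node. It follows that a node of the pattern network is
strictly downstream from `L` exactly if the node at which it starts is not in `before next`
(`IONetwork.strictlyDownstream_iff`).

The nodes downstream are induced for every admissible family, generic or not. At an equilibrium
with invertible Jacobian `J`, the derivative of the branch of equilibria is a vector `x` such that
`J x` is supported at the input. A counting of equations and unknowns shows that the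
singularity of the homeostasis block of `L` gives a nonzero vector with this property which is
supported in `before next` (`IONetwork.exists_vector_before`). The solutions of the problem form a
line, so that `x` itself vanishes outside of `before next`
(`IONetwork.BackboneNode.inducesNode_of_not_mem_before`).

For a super-simple node `ρ` of `before next`, a family is built along a simple path in which the
nodes form a feedforward chain and the coupling out of `prev` changes its sign at the origin
(`IONetwork.chainFamily`). There the block of `L` is singular, while the response of `ρ` to the
input is not zero. Moreover, the origin is a regular zero of the system formed by the equations of
the equilibrium and the determinant of the block, in as many variables as there are equations, so
a nearby zero exists for all families that are close enough (`eventually_exists_zero`), and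
hyperbolicity and the response of `ρ` persist too. Hence the families for which `ρ` is not
homeostatic contain a nonempty open set. As the space of admissible families is a Baire space,
residual sets are dense, and `ρ` is not induced
(`IONetwork.BackboneNode.not_inducesNode_of_mem_before`). A backbone node that is not downstream
contains such a node `ρ`, its first node.
-/

/-! ### Simple paths of a relation -/

/-- `l` is the list of nodes of a simple path from `x` to `y` along the relation `r`. -/
def IsPath {V : Type*} (r : V → V → Prop) (x y : V) (l : List V) : Prop :=
  l.head? = some x ∧ l.getLast? = some y ∧ l.Nodup ∧ l.IsChain r

section Paths

variable {V : Type*} {r : V → V → Prop} {x y s t : V}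

theorem List.exists_first_split {p : V → Prop} {l : List V} (h : ∃ x ∈ l, p x) :
    ∃ l₁ b l₂, l = l₁ ++ b :: l₂ ∧ p b ∧ ∀ d ∈ l₁, ¬ p d := by
  classical
  induction l with
  | nil => simp at h
  | cons a l ih =>
    by_cases ha : p a
    · exact ⟨[], a, l, rfl, ha, by simp⟩
    · obtain ⟨l₁, b, l₂, rfl, hb, hd⟩ := ih (by grind)
      exact ⟨a :: l₁, b, l₂, rfl, hb, by grind⟩

theorem List.exists_last_split {p : V → Prop} {l : List V} (h : ∃ x ∈ l, p x) :
    ∃ l₁ b l₂, l = l₁ ++ b :: l₂ ∧ p b ∧ ∀ d ∈ l₂, ¬ p d := by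
  obtain ⟨l₁, b, l₂, hl, hb, hd⟩ := List.exists_first_split (l := l.reverse) (p := p) (by simpa)
  refine ⟨l₂.reverse, b, l₁.reverse, ?_, hb, by simpa⟩
  rw [← List.reverse_reverse l, hl]
  simp

theorem IsPath.mono {r' : V → V → Prop} (h : ∀ a b, r a b → r' a b) {l : List V}
    (hl : IsPath r x y l) : IsPath r' x y l :=
  ⟨hl.1, hl.2.1, hl.2.2.1, hl.2.2.2.imp h⟩

theorem IsPath.left_mem {l : List V} (hl : IsPath r x y l) : x ∈ l :=
  List.mem_of_head? hl.1

theorem IsPath.right_mem {l : List V} (hl : IsPath r x y l) : y ∈ l :=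
  List.mem_of_getLast? hl.2.1

theorem IsPath.nodup {l : List V} (hl : IsPath r x y l) : l.Nodup := hl.2.2.1

theorem IsPath.append {v : V} {l₁ l₂ : List V} (h₁ : IsPath r x v (l₁ ++ [v]))
    (h₂ : IsPath r v y (v :: l₂)) (hd : ∀ a ∈ l₁, a ∉ l₂) : IsPath r x y (l₁ ++ v :: l₂) := by
  obtain ⟨a1, a2, a3, a4⟩ := h₁
  obtain ⟨b1, b2, b3, b4⟩ := h₂
  refine ⟨by cases l₁ <;> simp_all, by simp_all [List.getLast?_append], ?_, ?_⟩
  · grind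
  · exact List.isChain_split.2 ⟨a4, b4⟩

theorem IsPath.left {v : V} {l₁ l₂ : List V} (h : IsPath r x y (l₁ ++ v :: l₂)) :
    IsPath r x v (l₁ ++ [v]) := by
  obtain ⟨a1, a2, a3, a4⟩ := h
  exact ⟨by cases l₁ <;> simp_all, by simp, by grind, (List.isChain_split.1 a4).1⟩

theorem IsPath.right {v : V} {l₁ l₂ : List V} (h : IsPath r x y (l₁ ++ v :: l₂)) :
    IsPath r v y (v :: l₂) := by
  obtain ⟨a1, a2, a3, a4⟩ := h
  exact ⟨by simp, by simpa [List.getLast?_append] using a2, by grind, (List.isChain_split.1 a4).2⟩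

theorem IsPath.singleton (x : V) : IsPath r x x [x] := by simp [IsPath]

theorem IsPath.cons {z : V} {l : List V} (h : IsPath r y z l) (hxy : r x y) (hx : x ∉ l) :
    IsPath r x z (x :: l) := by
  obtain ⟨a1, a2, a3, a4⟩ := h
  cases l with
  | nil => simp at a1
  | cons b l =>
    simp only [List.head?_cons, Option.some.injEq] at a1
    subst a1
    exact ⟨by simp, by simpa using a2, by grind, by simp [hxy, a4]⟩

theorem IsPath.concat {z : V} {l : List V} (h : IsPath r x y l) (hyz : r y z) (hz : z ∉ l) :
    IsPath r x z (l ++ [z]) := by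
  obtain ⟨a1, a2, a3, a4⟩ := h
  refine ⟨by cases l <;> simp_all, by simp, by grind, ?_⟩
  rw [List.isChain_append]
  refine ⟨a4, by simp, ?_⟩
  intro u hu v hv
  simp at hv
  grind

theorem exists_isPath (h : Relation.ReflTransGen r x y) : ∃ l, IsPath r x y l := by
  induction h using Relation.ReflTransGen.head_induction_on with
  | refl => exact ⟨[y], .singleton y⟩
  | @head a c hac _ ih =>
    obtain ⟨l, hl⟩ := ih
    by_cases ha : a ∈ l
    · obtain ⟨l₁, l₂, rfl⟩ := List.append_of_mem ha
      exact ⟨_, hl.right⟩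
    · exact ⟨_, hl.cons hac ha⟩

/-- A path, as a walk among its own nodes. -/
theorem IsPath.reflTransGen {l : List V} (h : IsPath r x y l) :
    Relation.ReflTransGen (fun a b => r a b ∧ a ∈ l ∧ b ∈ l) x y := by
  induction l generalizing x with
  | nil => simp [IsPath] at h
  | cons a l ih =>
    have hax : a = x := by simpa using h.1
    subst hax
    cases l with
    | nil =>
      have : a = y := by simpa using h.2.1
      subst this
      exact .refl
    | cons b l =>
      have hb : IsPath r b y (b :: l) := IsPath.right (l₁ := [a]) h
      have hab : r a b := by have := h.2.2.2; simp at this; exact this.1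
      refine .head (b := b) ⟨hab, by simp, by simp⟩ ((ih hb).lift id ?_)
      rintro u v ⟨h1, h2, h3⟩
      exact ⟨h1, List.mem_cons_of_mem _ h2, List.mem_cons_of_mem _ h3⟩

/-- A path that meets `A` and ends in `C` contains an excursion from `A` to `C` whose interior avoids
both sets. -/
theorem IsPath.exists_crossing {A C : V → Prop} {l : List V} (h : IsPath r x y l)
    (hA : ∃ a ∈ l, A a) (hy : C y) (hAC : ∀ a, A a → ¬ C a) :
    ∃ c b D, A c ∧ C b ∧ IsPath r c b (c :: D ++ [b]) ∧ (∀ d ∈ D, ¬ A d ∧ ¬ C d ∧ d ∈ l) ∧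
      c ∈ l ∧ b ∈ l := by
  obtain ⟨l₁, c, l₂, rfl, hc, hl₂⟩ := List.exists_last_split hA
  have h2 := h.right
  have hyl : y ∈ l₂ := by
    have := h2.right_mem
    rcases List.mem_cons.1 this with rfl | h
    · exact absurd hy (hAC _ hc)
    · exact h
  obtain ⟨D, b, l₃, rfl, hb, hD⟩ := List.exists_first_split (p := C) ⟨y, hyl, hy⟩
  refine ⟨c, b, D, hc, hb, ?_, ?_, by simp, by simp⟩
  · have : IsPath r c y ((c :: D) ++ b :: l₃) := by simpa using h2
    exact this.left
  · intro d hd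
    exact ⟨hl₂ d (by simp [hd]), hD d hd, by simp [hd]⟩

/-- One augmentation step: two paths that share the stretch from `q` to `t` are rerouted along an
excursion from the first of them to a later node `b` of the shared stretch. -/
theorem IsPath.augment {q c b : V} {A₁ A₂ β C₁ C₂ D : List V}
    (hα : IsPath r s t ((A₁ ++ c :: A₂) ++ q :: (C₁ ++ b :: C₂)))
    (hβ : IsPath r s t (β ++ q :: (C₁ ++ b :: C₂)))
    (hd : ∀ x ∈ A₁ ++ c :: A₂, x ∈ β → x = s)
    (hD : IsPath r c b (c :: D ++ [b]))
    (hDα : ∀ d ∈ D, d ∉ A₁ ++ c :: A₂) (hDβ : ∀ d ∈ D, d ∉ β)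
    (hDC : ∀ d ∈ D, d ≠ q ∧ d ∉ C₁ ++ b :: C₂) :
    IsPath r s t ((A₁ ++ c :: D) ++ b :: C₂) ∧ IsPath r s t ((β ++ q :: C₁) ++ b :: C₂) ∧
      ∀ x ∈ A₁ ++ c :: D, x ∈ β ++ q :: C₁ → x = s := by
  have hn := hα.nodup
  refine ⟨?_, by simpa using hβ, ?_⟩
  · have e1 : IsPath r s c (A₁ ++ [c]) := by
      have : IsPath r s t (A₁ ++ c :: (A₂ ++ q :: (C₁ ++ b :: C₂))) := by simpa using hα
      exact this.left
    have e2 : IsPath r b t (b :: C₂) := by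
      have : IsPath r s t (((A₁ ++ c :: A₂) ++ q :: C₁) ++ b :: C₂) := by simpa using hα
      exact this.right
    have e3 : IsPath r c t ((c :: D) ++ b :: C₂) := hD.append e2 (by grind)
    have := e1.append (l₂ := D ++ b :: C₂) (by simpa using e3) (by grind)
    simpa using this
  · grind

/-- The case of two paths of Menger's theorem: if no third node separates `s` from `t`, there are
two simple paths from `s` to `t` with no other node in common. -/
theorem exists_disjoint_paths (hst : s ≠ t) (hp : ∃ l, IsPath r s t l)
    (hcut : ∀ q, q ≠ s → q ≠ t → ∃ l, IsPath r s t l ∧ q ∉ l) :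
    ∃ α β, IsPath r s t (α ++ [t]) ∧ IsPath r s t (β ++ [t]) ∧ ∀ x ∈ α, x ∈ β → x = s := by
  -- The two paths are disjoint up to a node `q`, from where they share the stretch `q :: C`.
  have main : ∀ n, ∀ α β q C, C.length = n → q ≠ s → IsPath r s t (α ++ q :: C) →
      IsPath r s t (β ++ q :: C) → (∀ x ∈ α, x ∈ β → x = s) →
      ∃ α β, IsPath r s t (α ++ [t]) ∧ IsPath r s t (β ++ [t]) ∧ ∀ x ∈ α, x ∈ β → x = s := by
    intro n
    induction n using Nat.strong_induction_on with
    | _ n ih =>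
    intro α β q C hn hqs hα hβ hd
    by_cases hqt : q = t
    · have hC : C = [] := by
        have h1 := hα.right
        by_contra hne
        have h2 := h1.2.1
        rw [List.getLast?_cons] at h2
        have h3 := h1.nodup
        have : q ∈ C := by
          subst hqt
          rw [List.getLast?_eq_some_getLast hne] at h2
          simp at h2
          rw [← h2]; exact List.getLast_mem hne
        grind
      subst hC hqt
      exact ⟨α, β, hα, hβ, hd⟩
    · obtain ⟨l, hl, hql⟩ := hcut q hqs hqt
      have hsα : s ∈ α := by
        have := hα.1
        cases α <;> simp_all
      have htC : t ∈ C := by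
        have := hα.right.right_mem
        grind
      have nα := hα.nodup
      have nβ := hβ.nodup
      obtain ⟨c, b, D, hc, hb, hD, hDl, hcl, hbl⟩ := hl.exists_crossing
        (A := fun x => x ∈ α ∨ x ∈ β) (C := fun x => x ∈ C) ⟨s, hl.left_mem, .inl hsα⟩ htC
        (by grind)
      obtain ⟨C₁, C₂, rfl⟩ := List.append_of_mem hb
      have hlen : C₂.length < n := by rw [← hn]; simp; omega
      rcases hc with hc | hc
      · obtain ⟨A₁, A₂, rfl⟩ := List.append_of_mem hc
        obtain ⟨h1, h2, h3⟩ := IsPath.augment hα hβ hd hD (by grind) (by grind) (by grind)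
        exact ih _ hlen _ _ b C₂ rfl (by grind) h1 h2 h3
      · obtain ⟨A₁, A₂, rfl⟩ := List.append_of_mem hc
        obtain ⟨h1, h2, h3⟩ := IsPath.augment hβ hα (by grind) hD (by grind) (by grind) (by grind)
        exact ih _ hlen _ _ b C₂ rfl (by grind) h1 h2 h3
  obtain ⟨l, hl⟩ := hp
  have h1 := hl.1
  cases l with
  | nil => simp at h1
  | cons a l =>
    have : a = s := by simpa using h1
    subst this
    cases l with
    | nil =>
      have := hl.2.1
      simp at this
      exact absurd this hst
    | cons q C =>
      exact main _ [a] [a] q C rfl (by have := hl.nodup; grind) hl hl (by simp)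

end Paths

/-! ### Strong components off a simple path -/

section Components

open Relation

variable {V : Type*} {r : V → V → Prop} {x y s t : V}

theorem IsPath.forall_mem {P : V → Prop} {l : List V} (hl : IsPath r x y l) (hx : P x)
    (h : ∀ u v, r u v → P v) : ∀ z ∈ l, P z := by
  induction l generalizing x with
  | nil => simp
  | cons a l ih =>
    have hax : a = x := by simpa using hl.1
    subst hax
    cases l with
    | nil => simpa using hx
    | cons b l =>
      have hb : IsPath r b y (b :: l) := IsPath.right (l₁ := [a]) hl
      have hab : r a b := by have := hl.2.2.2; simp at this; exact this.1
      have := ih hb (h _ _ hab)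
      intro z hz
      rcases List.mem_cons.1 hz with rfl | hz
      · exact hx
      · exact this z hz

theorem exists_last_exit {A : V → Prop} (h : ReflTransGen r x y) (hx : A x) (hy : ¬ A y) :
    ∃ c u, A c ∧ r c u ∧ ¬ A u ∧ ReflTransGen (fun a b => r a b ∧ ¬ A a ∧ ¬ A b) u y := by
  induction h with
  | refl => exact absurd hx hy
  | @tail b z _ hbz ih =>
    by_cases hb : A b
    · exact ⟨b, z, hb, hbz, hy, .refl⟩
    · obtain ⟨c, u, h1, h2, h3, h4⟩ := ih hb
      exact ⟨c, u, h1, h2, h3, h4.tail ⟨hbz, hb, hy⟩⟩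

theorem exists_first_entry {A : V → Prop} (h : ReflTransGen r x y) (hx : ¬ A x) (hy : A y) :
    ∃ v b, A b ∧ r v b ∧ ¬ A v ∧ ReflTransGen (fun a b => r a b ∧ ¬ A a ∧ ¬ A b) x v := by
  induction h using ReflTransGen.head_induction_on with
  | refl => exact absurd hy hx
  | @head z b hzb _ ih =>
    by_cases hb : A b
    · exact ⟨z, b, hb, hzb, hx, .refl⟩
    · obtain ⟨v, c, h1, h2, h3, h4⟩ := ih hb
      exact ⟨v, c, h1, h2, h3, .head ⟨hzb, hx, hb⟩ h4⟩

/-- If `x` leads to `a` and `a` leads to `y`, then some simple path from `x` to `y` meets the strong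
component of `a`, although it need not contain `a`. -/
theorem exists_isPath_meets_component {a : V} (hxa : ReflTransGen r x a)
    (hay : ReflTransGen r a y) :
    ∃ p, IsPath r x y p ∧ ∃ w ∈ p, ReflTransGen r a w ∧ ReflTransGen r w a := by
  induction hxa using ReflTransGen.head_induction_on with
  | refl =>
    obtain ⟨p, hp⟩ := exists_isPath hay
    exact ⟨p, hp, a, hp.left_mem, .refl, .refl⟩
  | @head z b hzb hba ih =>
    obtain ⟨p, hp, w, hw, haw, hwa⟩ := ih
    by_cases hz : z ∈ p
    · obtain ⟨l₁, l₂, rfl⟩ := List.append_of_mem hz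
      by_cases hw2 : w ∈ z :: l₂
      · exact ⟨_, hp.right, w, hw2, haw, hwa⟩
      · -- `z` comes after `w`, hence lies in the component itself
        have hw1 : w ∈ l₁ := by grind
        obtain ⟨m₁, m₂, rfl⟩ := List.append_of_mem hw1
        have h1 : IsPath r b y (m₁ ++ w :: (m₂ ++ z :: l₂)) := by simpa using hp
        have h2 : IsPath r w y ((w :: m₂) ++ z :: l₂) := h1.right
        have h3 : ReflTransGen r w z := h2.left.reflTransGen.lift id (fun _ _ h => h.1)
        exact ⟨_, hp.right, z, by simp, haw.trans h3, .head hzb hba⟩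
    · exact ⟨_, hp.cons hzb hz, w, by simp [hw], haw, hwa⟩

/-- A node on an ear `c → u ⇝ v → b` of the path `α ++ [t]` whose interior avoids two disjoint paths:
either the ear reroutes a path, or it closes up to a cycle that avoids the other path. -/
theorem exists_path_component_of_ear {α β : List V} {a b c u v : V}
    (hα : IsPath r s t (α ++ [t])) (hβ : IsPath r s t (β ++ [t])) (hd : ∀ x ∈ α, x ∈ β → x = s)
    (hbs : b ≠ s) (hc : c ∈ α) (hb : b ∈ α ∨ b ∈ β ∨ b = t) (hcu : r c u) (hvb : r v b)
    (hu : ¬ (u ∈ α ∨ u ∈ β ∨ u = t)) (hv : ¬ (v ∈ α ∨ v ∈ β ∨ v = t))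
    (hua : ReflTransGen (fun x y => r x y ∧ ¬ (x ∈ α ∨ x ∈ β ∨ x = t) ∧
      ¬ (y ∈ α ∨ y ∈ β ∨ y = t)) u a)
    (hav : ReflTransGen (fun x y => r x y ∧ ¬ (x ∈ α ∨ x ∈ β ∨ x = t) ∧
      ¬ (y ∈ α ∨ y ∈ β ∨ y = t)) a v) :
    ∃ P, IsPath r s t P ∧ ∃ w l, IsPath r s t l ∧ w ∈ l ∧ w ∉ P ∧
      ReflTransGen (fun x y => r x y ∧ x ∉ P ∧ y ∉ P) a w ∧
      ReflTransGen (fun x y => r x y ∧ x ∉ P ∧ y ∉ P) w a := by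
  obtain ⟨p, hp, w, hw, haw, hwa⟩ := exists_isPath_meets_component hua hav
  have hpW := hp.forall_mem (P := fun x => ¬ (x ∈ α ∨ x ∈ β ∨ x = t)) hu (fun x y h => h.2.2)
  have hpr : IsPath r u v p := hp.mono fun _ _ h => h.1
  have nα := hα.nodup
  have nβ := hβ.nodup
  have hsα : s ∈ α ++ [t] := hα.left_mem
  have hsβ : s ∈ β ++ [t] := hβ.left_mem
  obtain ⟨A₁, A₂, rfl⟩ := List.append_of_mem hc
  have hα1 : IsPath r s t (A₁ ++ c :: (A₂ ++ [t])) := by simpa using hα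
  -- If `b` does not lie on the path before `c`, the ear gives a simple path through `w`.
  have key : ∀ B₁ B₂, IsPath r s t (B₁ ++ b :: B₂) → b ≠ c → (∀ x ∈ A₁ ++ [c], x ∉ b :: B₂) →
      (∀ x ∈ p, x ∉ b :: B₂) → ∃ P, IsPath r s t P ∧ ∃ w l, IsPath r s t l ∧ w ∈ l ∧ w ∉ P ∧
      ReflTransGen (fun x y => r x y ∧ x ∉ P ∧ y ∉ P) a w ∧
      ReflTransGen (fun x y => r x y ∧ x ∉ P ∧ y ∉ P) w a := by
    intro B₁ B₂ hB hbc hdis hpB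
    have e1 : IsPath r c v (c :: p) := hpr.cons hcu (by grind)
    have e2 : IsPath r c b (c :: p ++ [b]) := e1.concat hvb (by grind)
    have e3 : IsPath r c t (c :: p ++ b :: B₂) := e2.append hB.right (by grind)
    have e4 : IsPath r s t (A₁ ++ c :: (p ++ b :: B₂)) :=
      hα1.left.append (by simpa using e3) (by grind)
    refine ⟨_, hα, w, _, e4, by simp [hw], by grind, ?_, ?_⟩
    · exact haw.lift id fun x y h => ⟨h.1, by grind, by grind⟩
    · exact hwa.lift id fun x y h => ⟨h.1, by grind, by grind⟩
  by_cases hb2 : b ∈ A₂ ++ [t]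
  · obtain ⟨X, Y, hXY⟩ := List.append_of_mem hb2
    have hα2 : IsPath r s t ((A₁ ++ c :: X) ++ b :: Y) := by rw [hXY] at hα1; simpa using hα1
    have n2 := hα2.nodup
    have hsub : ∀ x ∈ b :: Y, x ∈ A₂ ++ [t] := by rw [hXY]; grind
    exact key _ _ hα2 (by grind) (by grind) (by grind)
  by_cases hb3 : b ∈ β
  · obtain ⟨B₁, B₂, rfl⟩ := List.append_of_mem hb3
    have hβ2 : IsPath r s t (B₁ ++ b :: (B₂ ++ [t])) := by simpa using hβ
    have hsB : s ∈ B₁ := by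
      have := hβ2.1
      cases B₁ with
      | nil => simp at this; exact absurd this hbs
      | cons => simp at this; simp [this]
    exact key _ _ hβ2 (by grind) (by grind) (by grind)
  -- `b` lies on `α` not after `c`: the ear closes up to a cycle that avoids `β`.
  have hb4 : b ∈ A₁ ++ [c] := by grind
  obtain ⟨X, Y, hXY⟩ := List.append_of_mem hb4
  have e1 : IsPath r b c (b :: Y) := by
    have := hα1.left
    rw [hXY] at this
    exact this.right
  have hsX : s ∈ X := by
    have := hα1.left.1
    rw [hXY] at this
    cases X with
    | nil => simp at this; exact absurd this hbs
    | cons => simp at this; simp [this]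
  have n1 : (X ++ b :: Y).Nodup := by rw [← hXY]; exact hα1.left.nodup
  have hsub : ∀ x ∈ X ++ b :: Y, x ∈ A₁ ++ [c] := by rw [hXY]; simp
  have hoff : ∀ x ∈ b :: Y, x ∉ β ++ [t] := by
    intro x hx hxβ
    have hxα : x ∈ A₁ ++ c :: A₂ := by
      have := hsub x (List.mem_append_right _ hx)
      simp at this ⊢; tauto
    have hxt : x ≠ t := fun h => (List.nodup_append.1 nα).2.2 x hxα t (by simp) h
    have hxs := hd x hxα (by simpa [hxt] using hxβ)
    exact (List.nodup_append.1 n1).2.2 s hsX x hx hxs.symm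
  have hout : ∀ x, ¬ (x ∈ A₁ ++ c :: A₂ ∨ x ∈ β ∨ x = t) → x ∉ β ++ [t] := by
    intro x hx; simp at hx ⊢; tauto
  have hbα : b ∈ (A₁ ++ c :: A₂) ++ [t] := by simp at hb4 ⊢; tauto
  have hcY : c ∈ b :: Y := e1.right_mem
  refine ⟨_, hβ, b, _, hα, hbα, hoff b (by simp), ?_, ?_⟩
  · exact ReflTransGen.tail (b := v) (hav.lift id fun x y h => ⟨h.1, hout _ h.2.1, hout _ h.2.2⟩)
      ⟨hvb, hout _ hv, hoff b (by simp)⟩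
  · refine (e1.reflTransGen.lift id fun x y h => ?_).trans
      (ReflTransGen.head (b := u) (a := c) ?_ (hua.lift id fun x y h => ?_))
    · exact ⟨h.1, hoff _ h.2.1, hoff _ h.2.2⟩
    · exact ⟨hcu, hoff _ hcY, hout _ hu⟩
    · exact ⟨h.1, hout _ h.2.1, hout _ h.2.2⟩

/-- Suppose that no third node separates `s` from `t`. Then a node between `s` and `t` lies on a
simple path from `s` to `t`, or its strong component off some such path `P` contains a node of
another such path. -/
theorem exists_path_mem_or_component_meets {a : V} (hst : s ≠ t) (hs : ∀ x, ¬ r x s)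
    (ht : ∀ x, ¬ r t x) (hcut : ∀ q, q ≠ s → q ≠ t → ∃ l, IsPath r s t l ∧ q ∉ l)
    (hsa : ReflTransGen r s a) (hat : ReflTransGen r a t) :
    ∃ P, IsPath r s t P ∧ (a ∈ P ∨ ∃ w l, IsPath r s t l ∧ w ∈ l ∧ w ∉ P ∧
      ReflTransGen (fun x y => r x y ∧ x ∉ P ∧ y ∉ P) a w ∧
      ReflTransGen (fun x y => r x y ∧ x ∉ P ∧ y ∉ P) w a) := by
  obtain ⟨α, β, hα, hβ, hd⟩ := exists_disjoint_paths hst (exists_isPath (hsa.trans hat)) hcut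
  by_cases haα : a ∈ α ++ [t]
  · exact ⟨_, hα, .inl haα⟩
  by_cases haβ : a ∈ β ++ [t]
  · exact ⟨_, hβ, .inl haβ⟩
  have ha : ¬ (a ∈ α ∨ a ∈ β ∨ a = t) := by grind
  have hsα : s ∈ α := by have := hα.left_mem; grind
  obtain ⟨c, u, hc, hcu, hu, hua⟩ :=
    exists_last_exit (A := fun x => x ∈ α ∨ x ∈ β ∨ x = t) hsa (.inl hsα) ha
  obtain ⟨v, b, hb, hvb, hv, hav⟩ :=
    exists_first_entry (A := fun x => x ∈ α ∨ x ∈ β ∨ x = t) hat ha (.inr (.inr rfl))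
  have hbs : b ≠ s := fun h => hs v (h ▸ hvb)
  rcases hc with hc | hc | rfl
  · obtain ⟨P, hP, h⟩ := exists_path_component_of_ear hα hβ hd hbs hc hb hcu hvb hu hv hua hav
    exact ⟨P, hP, .inr h⟩
  · have e : ∀ x, (x ∈ α ∨ x ∈ β ∨ x = t) ↔ (x ∈ β ∨ x ∈ α ∨ x = t) := fun x => by tauto
    simp only [e] at hb hu hv hua hav
    obtain ⟨P, hP, h⟩ := exists_path_component_of_ear hβ hα (fun x h1 h2 => hd x h2 h1)
      hbs hc hb hcu hvb hu hv hua hav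
    exact ⟨P, hP, .inr h⟩
  · exact absurd hcu (ht u)

end Components

/-! ### The two sides of a super-simple node -/

section Sides

open Relation

theorem IsPath.restrict {V : Type*} {r : V → V → Prop} {x y : V} {l : List V}
    (h : IsPath r x y l) :
    IsPath (fun u v => r u v ∧ (u ∈ l ∧ u ≠ y) ∧ (v ∈ l ∧ v ≠ x)) x y l := by
  refine ⟨h.1, h.2.1, h.2.2.1, ?_⟩
  rw [List.isChain_iff_forall_rel_of_append_cons_cons]
  rintro a b l₁ l₂ rfl
  refine ⟨List.isChain_iff_forall_rel_of_append_cons_cons.1 h.2.2.2 rfl, ⟨by simp, ?_⟩,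
    by simp, ?_⟩
  · rintro rfl
    have h1 : IsPath r a a (a :: b :: l₂) := h.right
    have h2 := h1.2.1
    have h3 := h1.nodup
    rw [List.getLast?_cons_cons] at h2
    have := List.mem_of_getLast? h2
    grind
  · rintro rfl
    have h1 := h.1
    have h3 := h.nodup
    cases l₁ with
    | nil => simp at h1; grind
    | cons c l₁ => simp at h1; grind

theorem List.pair_sublist_iff {V : Type*} {a b : V} {S : List V} :
    [a, b].Sublist S ↔ ∃ l₁ l₂ l₃, S = l₁ ++ a :: (l₂ ++ b :: l₃) := by
  constructor
  · intro h
    obtain ⟨r₁, r₂, rfl, h1, h2⟩ := List.cons_sublist_iff.1 h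
    obtain ⟨l₁, m, rfl⟩ := List.append_of_mem h1
    obtain ⟨n, l₃, rfl⟩ := List.append_of_mem (List.singleton_sublist.1 h2)
    exact ⟨l₁, m ++ n, l₃, by simp⟩
  · rintro ⟨l₁, l₂, l₃, rfl⟩
    refine List.Sublist.trans ?_ (List.sublist_append_right _ _)
    refine List.Sublist.cons_cons _ ?_
    exact List.singleton_sublist.2 (by simp)

namespace IONetwork

variable {V : Type*} (G : IONetwork V)

/-- The nodes that can be reached from the input node without meeting `b`. -/
def before (b : V) : Set V :=
  {v | v ≠ b ∧ ReflTransGen (fun x y => G.graph.Adj x y ∧ x ≠ b ∧ y ≠ b) G.input v}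

/-- The nodes from which the output node can be reached without meeting `b`. -/
def after (b : V) : Set V :=
  {v | v ≠ b ∧ ReflTransGen (fun x y => G.graph.Adj x y ∧ x ≠ b ∧ y ≠ b) v G.output}

variable {G} {a b v w : V} {S l₁ l₂ : List V}

theorem not_mem_before_self : b ∉ G.before b := fun h => h.1 rfl

theorem input_ne_of_mem_before (h : v ∈ G.before b) : G.input ≠ b := by
  rcases ReflTransGen.cases_head h.2 with h1 | ⟨c, h1, -⟩
  · rw [h1]; exact h.1
  · exact h1.2.1

theorem mem_before_of_adj (hv : v ∈ G.before b) (h : G.graph.Adj v w) (hw : w ≠ b) :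
    w ∈ G.before b :=
  ⟨hw, hv.2.tail ⟨h, hv.1, hw⟩⟩

theorem mem_after_of_adj (hw : w ∈ G.after b) (h : G.graph.Adj v w) (hv : v ≠ b) :
    v ∈ G.after b :=
  ⟨hv, .head ⟨h, hv, hw.1⟩ hw.2⟩

theorem mem_before_of_complement (hv : v ∈ G.before b) (hb : b ∈ S)
    (h : ReflTransGen (G.ComplementArrow S) v w) : w ∈ G.before b := by
  induction h with
  | refl => exact hv
  | tail _ h ih => exact mem_before_of_adj ih h.2.2 fun e => h.2.1 (e ▸ hb)

theorem mem_after_of_complement (hw : w ∈ G.after b) (hb : b ∈ S)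
    (h : ReflTransGen (G.ComplementArrow S) v w) : v ∈ G.after b := by
  induction h using ReflTransGen.head_induction_on with
  | refl => exact hw
  | head h _ ih => exact mem_after_of_adj ih h.2.2 fun e => h.1 (e ▸ hb)

theorem IsIOPath.mem_before (h : G.IsIOPath (l₁ ++ v :: l₂)) (hb : b ∉ l₁ ++ [v]) :
    v ∈ G.before b := by
  have h1 : IsPath G.graph.Adj G.input v (l₁ ++ [v]) := IsPath.left h
  refine ⟨by rintro rfl; simp at hb, h1.reflTransGen.lift id ?_⟩
  rintro x y ⟨h1, h2, h3⟩
  exact ⟨h1, fun e => hb (e ▸ h2), fun e => hb (e ▸ h3)⟩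

theorem IsIOPath.mem_after (h : G.IsIOPath (l₁ ++ v :: l₂)) (hb : b ∉ v :: l₂) :
    v ∈ G.after b := by
  have h1 : IsPath G.graph.Adj v G.output (v :: l₂) := IsPath.right h
  refine ⟨by rintro rfl; simp at hb, h1.reflTransGen.lift id ?_⟩
  rintro x y ⟨h1, h2, h3⟩
  exact ⟨h1, fun e => hb (e ▸ h2), fun e => hb (e ▸ h3)⟩

/-- A super-simple node separates the two sets of nodes. -/
theorem IsSuperSimple.not_mem_after (hb : G.IsSuperSimple b) (hv : v ∈ G.before b) :
    v ∉ G.after b := by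
  intro h
  obtain ⟨l, hl⟩ := exists_isPath (hv.2.trans h.2)
  have h1 := hl.forall_mem (P := fun x => x ≠ b) (input_ne_of_mem_before hv) fun _ _ h => h.2.2
  exact h1 b (hb.2 l (hl.mono fun _ _ h => h.1)) rfl

theorem mem_before_of_split (h : G.IsIOPath (l₁ ++ b :: l₂)) (hv : v ∈ l₁) : v ∈ G.before b := by
  obtain ⟨m₁, m₂, rfl⟩ := List.append_of_mem hv
  have hn := IsPath.nodup h
  refine IsIOPath.mem_before (l₂ := m₂ ++ b :: l₂) (by simpa using h) ?_
  grind

theorem mem_after_of_split (h : G.IsIOPath (l₁ ++ b :: l₂)) (hv : v ∈ l₂) : v ∈ G.after b := by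
  obtain ⟨m₁, m₂, rfl⟩ := List.append_of_mem hv
  have hn := IsPath.nodup h
  refine IsIOPath.mem_after (l₁ := l₁ ++ b :: m₁) (l₂ := m₂) (by simpa using h) ?_
  grind

theorem IsSuperSimple.exists_split_before (hb : G.IsSuperSimple b) (hS : G.IsIOPath S)
    (hv : v ∈ S) (hvb : v ∈ G.before b) : ∃ l₁ l₂ l₃, S = l₁ ++ v :: (l₂ ++ b :: l₃) := by
  obtain ⟨m₁, m₂, rfl⟩ := List.append_of_mem (hb.2 S hS)
  have : v ∈ m₁ := by
    by_contra h
    have : v ∈ m₂ := by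
      have := hvb.1
      grind
    exact hb.not_mem_after hvb (mem_after_of_split hS this)
  obtain ⟨l₁, l₂, rfl⟩ := List.append_of_mem this
  exact ⟨l₁, l₂, m₂, by simp⟩

theorem IsSuperSimple.exists_split_after (hb : G.IsSuperSimple b) (hS : G.IsIOPath S)
    (hv : v ∈ S) (hvb : v ∈ G.after b) : ∃ l₁ l₂ l₃, S = l₁ ++ b :: (l₂ ++ v :: l₃) := by
  obtain ⟨m₁, m₂, rfl⟩ := List.append_of_mem (hb.2 S hS)
  have : v ∈ m₂ := by
    by_contra h
    have : v ∈ m₁ := by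
      have := hvb.1
      grind
    exact hb.not_mem_after (mem_before_of_split hS this) hvb
  obtain ⟨l₁, l₂, rfl⟩ := List.append_of_mem this
  exact ⟨m₁, l₁, l₂, by simp⟩

theorem IsSimple.mem_before_or_after (hv : G.IsSimple v) (hb : G.IsSuperSimple b) (h : v ≠ b) :
    v ∈ G.before b ∨ v ∈ G.after b := by
  obtain ⟨S, hS, hv⟩ := hv
  obtain ⟨m₁, m₂, rfl⟩ := List.append_of_mem (hb.2 S hS)
  rcases List.mem_append.1 hv with h1 | h1
  · exact .inl (mem_before_of_split hS h1)
  · exact .inr (mem_after_of_split hS (by simpa [h] using h1))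

theorem IsSuperSimple.mem_before_iff (ha : G.IsSuperSimple a) (hb : G.IsSuperSimple b) :
    a ∈ G.before b ↔ b ∈ G.after a := by
  obtain ⟨S, hS, haS⟩ := ha.1
  constructor
  · intro h
    obtain ⟨l₁, l₂, l₃, rfl⟩ := hb.exists_split_before hS haS h
    exact mem_after_of_split hS (by simp)
  · intro h
    obtain ⟨l₁, l₂, l₃, rfl⟩ := ha.exists_split_after hS (hb.2 S hS) h
    exact mem_before_of_split (l₁ := l₁ ++ a :: l₂) (l₂ := l₃) (by simpa using hS) (by simp)

theorem IsSuperSimple.before_subset (ha : G.IsSuperSimple a) (hb : G.IsSuperSimple b)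
    (h : a ∈ G.before b) : G.before a ⊆ G.before b := by
  have hba : b ∉ G.before a := fun h1 => ha.not_mem_after h1 ((ha.mem_before_iff hb).1 h)
  rintro v ⟨hva, hv⟩
  induction hv with
  | refl => exact ⟨input_ne_of_mem_before h, .refl⟩
  | @tail u w hu huw ih =>
    refine mem_before_of_adj (ih huw.2.1) huw.1 ?_
    rintro rfl
    exact hba ⟨hva, hu.tail huw⟩

theorem IsSuperSimple.mem_before_or_after (ha : G.IsSuperSimple a) (hb : G.IsSuperSimple b)
    (h : a ≠ b) : a ∈ G.before b ∨ b ∈ G.before a := by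
  rw [hb.mem_before_iff ha]
  exact ha.1.mem_before_or_after hb h

theorem Precedes.mem_before (h : G.Precedes a b) : a ∈ G.before b := by
  obtain ⟨S, hS, hab, -⟩ := h
  obtain ⟨l₁, l₂, l₃, rfl⟩ := List.pair_sublist_iff.1 hab
  exact mem_before_of_split (l₁ := l₁ ++ a :: l₂) (l₂ := l₃) (by simpa using hS) (by simp)

theorem Precedes.mem_after (h : G.Precedes a b) : b ∈ G.after a := by
  obtain ⟨S, hS, hab, -⟩ := h
  obtain ⟨l₁, l₂, l₃, rfl⟩ := List.pair_sublist_iff.1 hab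
  exact mem_after_of_split hS (by simp)

theorem IsSimple.precedes_of_mem_before (ha : G.IsSimple a) (hb : G.IsSuperSimple b)
    (h : a ∈ G.before b) : G.Precedes a b := by
  obtain ⟨S, hS, haS⟩ := ha
  obtain h1 := List.pair_sublist_iff.2 (hb.exists_split_before hS haS h)
  exact ⟨S, hS, h1, b, hb, .inr h1, .inl rfl⟩

theorem IsSimple.precedes_of_mem_after (ha : G.IsSimple a) (hb : G.IsSuperSimple b)
    (h : a ∈ G.after b) : G.Precedes b a := by
  obtain ⟨S, hS, haS⟩ := ha
  obtain h1 := List.pair_sublist_iff.2 (hb.exists_split_after hS haS h)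
  exact ⟨S, hS, h1, b, hb, .inl rfl, .inr h1⟩

end IONetwork

end Sides

/-! ### The nodes of a structural subnetwork -/

section Structural

open Relation

namespace IONetwork

namespace BackboneNode

variable {V : Type*} {G : IONetwork V} (L : G.BackboneNode)

/-- The nodes between two consecutive super-simple nodes: those that the input node reaches without
meeting the second one, and that reach the output node without meeting the first one. -/
def middle : Set V := G.before L.next ∩ G.after L.prev

/-- The arrows of the structural subnetwork, without those into `prev` and those out of `next`. -/
def LocalArrow (u v : V) : Prop :=
  G.graph.Adj u v ∧ (u ∈ L.middle ∨ u = L.prev) ∧ (v ∈ L.middle ∨ v = L.next)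

variable {L} {S P : List V} {a q v : V}

theorem prev_mem_before : L.prev ∈ G.before L.next :=
  L.prev_precedes_next.mem_before

theorem next_mem_after : L.next ∈ G.after L.prev :=
  L.prev_precedes_next.mem_after

theorem prev_ne_next : L.prev ≠ L.next := (prev_mem_before (L := L)).1

theorem prev_not_mem_middle : L.prev ∉ L.middle := fun h => h.2.1 rfl

theorem next_not_mem_middle : L.next ∉ L.middle := fun h => h.1.1 rfl

theorem not_superSimple_of_mem_middle (hq : q ∈ L.middle) : ¬ G.IsSuperSimple q := fun h =>
  L.consecutive q h ⟨h.1.precedes_of_mem_after L.prev_superSimple hq.2,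
    h.1.precedes_of_mem_before L.next_superSimple hq.1⟩

theorem mem_simpleSubnetwork_iff :
    v ∈ L.simpleSubnetwork ↔ G.IsSimple v ∧ v ∈ L.middle :=
  ⟨fun h => ⟨h.1, h.2.2.mem_before, h.2.1.mem_after⟩,
    fun h => ⟨h.1, h.1.precedes_of_mem_after L.prev_superSimple h.2.2,
      h.1.precedes_of_mem_before L.next_superSimple h.2.1⟩⟩

variable (L) in
/-- The stretch of a simple path from the input to the output between `prev` and `next`. -/
theorem exists_split (hS : G.IsIOPath S) : ∃ l₁ l₂ l₃,
    S = l₁ ++ L.prev :: (l₂ ++ L.next :: l₃) ∧ (∀ x ∈ l₁, x ∈ G.before L.prev) ∧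
      (∀ x ∈ l₂, x ∈ L.middle) ∧ ∀ x ∈ l₃, x ∈ G.after L.next := by
  obtain ⟨l₁, l₂, l₃, rfl⟩ := L.next_superSimple.exists_split_before hS
    (L.prev_superSimple.2 S hS) prev_mem_before
  have hS' : G.IsIOPath ((l₁ ++ L.prev :: l₂) ++ L.next :: l₃) := by simpa using hS
  refine ⟨l₁, l₂, l₃, rfl, fun x hx => mem_before_of_split hS hx,
    fun x hx => ⟨mem_before_of_split hS' (by simp [hx]),
      mem_after_of_split hS (by simp [hx])⟩,
    fun x hx => mem_after_of_split hS' hx⟩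

theorem isPath_localArrow {l₁ l₂ l₃ : List V}
    (hS : G.IsIOPath (l₁ ++ L.prev :: (l₂ ++ L.next :: l₃))) (h : ∀ x ∈ l₂, x ∈ L.middle) :
    IsPath L.LocalArrow L.prev L.next (L.prev :: (l₂ ++ [L.next])) := by
  have h1 : IsPath G.graph.Adj L.prev G.output ((L.prev :: l₂) ++ L.next :: l₃) := IsPath.right hS
  have h2 : IsPath G.graph.Adj L.prev L.next (L.prev :: (l₂ ++ [L.next])) := h1.left
  refine h2.restrict.mono ?_
  rintro u v ⟨h1, h2, h3⟩
  refine ⟨h1, ?_, ?_⟩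
  · have := h u; grind
  · have := h v; grind

theorem exists_isPath_localArrow_not_mem (h1 : q ≠ L.prev) (h2 : q ≠ L.next) :
    ∃ l, IsPath L.LocalArrow L.prev L.next l ∧ q ∉ l := by
  obtain ⟨S, hS, hq⟩ : ∃ S, G.IsIOPath S ∧ (q ∈ L.middle → q ∉ S) := by
    obtain ⟨S, hS, hs⟩ := L.prev_superSimple.1
    by_cases hq : q ∈ L.middle
    · have := not_superSimple_of_mem_middle hq
      simp only [IsSuperSimple, not_and_or, not_forall] at this
      rcases this with h | ⟨S, hS, h⟩
      · exact ⟨S, hS, fun _ hqS => h ⟨S, hS, hqS⟩⟩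
      · exact ⟨S, hS, fun _ => h⟩
    · exact ⟨S, hS, fun h => absurd h hq⟩
  obtain ⟨l₁, l₂, l₃, rfl, -, hm, -⟩ := L.exists_split hS
  refine ⟨_, isPath_localArrow hS hm, ?_⟩
  have := hm q
  grind

theorem reflTransGen_prev (ha : a ∈ L.middle) : ReflTransGen L.LocalArrow L.prev a := by
  have key : ∀ v, ReflTransGen (fun x y => G.graph.Adj x y ∧ x ≠ L.next ∧ y ≠ L.next) G.input v →
      v ≠ L.next → v ∈ G.after L.prev → ReflTransGen L.LocalArrow L.prev v := by
    intro v hv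
    induction hv with
    | refl =>
      intro _ h
      by_cases hi : G.input = L.prev
      · exact absurd hi h.1
      · exact absurd h (L.prev_superSimple.not_mem_after ⟨hi, .refl⟩)
    | @tail u w hu huw ih =>
      intro hw hwa
      have hwm : w ∈ L.middle := ⟨⟨hw, hu.tail huw⟩, hwa⟩
      by_cases hup : u = L.prev
      · exact .single ⟨hup ▸ huw.1, .inr rfl, .inl hwm⟩
      · have hua := mem_after_of_adj hwa huw.1 hup
        exact (ih huw.2.1 hua).tail ⟨huw.1, .inl ⟨⟨huw.2.1, hu⟩, hua⟩, .inl hwm⟩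
  exact key a ha.1.2 ha.1.1 ha.2

theorem reflTransGen_next (ha : a ∈ L.middle) : ReflTransGen L.LocalArrow a L.next := by
  have key : ∀ v, ReflTransGen (fun x y => G.graph.Adj x y ∧ x ≠ L.prev ∧ y ≠ L.prev) v G.output →
      v ≠ L.prev → v ∈ G.before L.next → ReflTransGen L.LocalArrow v L.next := by
    intro v hv
    induction hv using ReflTransGen.head_induction_on with
    | refl =>
      intro _ h
      by_cases hi : G.output = L.next
      · exact absurd hi h.1
      · exact absurd ⟨hi, .refl⟩ (L.next_superSimple.not_mem_after h)
    | @head u w huw hw ih =>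
      intro hu hub
      have hum : u ∈ L.middle := ⟨hub, hu, .head huw hw⟩
      by_cases hwn : w = L.next
      · exact .single ⟨hwn ▸ huw.1, .inl hum, .inr rfl⟩
      · have hwb := mem_before_of_adj hub huw.1 hwn
        exact .head ⟨huw.1, .inl hum, .inl ⟨hwb, huw.2.2, hw⟩⟩ (ih huw.2.2 hwb)
  exact key a ha.2.2 ha.2.1 ha.1

theorem isPath_localArrow_forall_mem (hP : IsPath L.LocalArrow L.prev L.next P) :
    ∀ x ∈ P, x ∈ L.middle ∨ x = L.prev ∨ x = L.next :=
  hP.forall_mem (.inr (.inl rfl)) fun _ _ h => h.2.2.imp id .inr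

/-- The stretch of a simple path between `prev` and `next` may be replaced. -/
theorem isIOPath_glue {l₁ l₂ l₃ : List V}
    (hS : G.IsIOPath (l₁ ++ L.prev :: (l₂ ++ L.next :: l₃)))
    (h₁ : ∀ x ∈ l₁, x ∈ G.before L.prev) (h₃ : ∀ x ∈ l₃, x ∈ G.after L.next)
    (hP : IsPath L.LocalArrow L.prev L.next P) : G.IsIOPath (l₁ ++ P ++ l₃) := by
  have hm := isPath_localArrow_forall_mem hP
  have hP' : IsPath G.graph.Adj L.prev L.next P := hP.mono fun _ _ h => h.1
  have hl : ∀ x ∈ l₁, x ∉ L.middle ∧ x ≠ L.next := fun x hx =>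
    ⟨fun h => L.prev_superSimple.not_mem_after (h₁ x hx) h.2,
      fun h => L.prev_superSimple.not_mem_after (h₁ x hx) (h ▸ next_mem_after)⟩
  have hr : ∀ x ∈ l₃, x ∉ L.middle ∧ x ≠ L.prev ∧ x ≠ L.next ∧ x ∉ l₁ := fun x hx =>
    ⟨fun h => L.next_superSimple.not_mem_after h.1 (h₃ x hx),
      fun h => L.next_superSimple.not_mem_after prev_mem_before (h ▸ h₃ x hx), (h₃ x hx).1,
      fun h => L.next_superSimple.not_mem_after (L.prev_superSimple.before_subset
        L.next_superSimple prev_mem_before (h₁ x h)) (h₃ x hx)⟩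
  obtain ⟨P', rfl⟩ : ∃ P', P = L.prev :: P' := by
    have := hP.1
    cases P with
    | nil => simp at this
    | cons c P => simp at this; exact ⟨P, by rw [this]⟩
  have e1 : IsPath G.graph.Adj G.input L.next (l₁ ++ L.prev :: P') := by
    refine IsPath.append (IsPath.left hS) hP' ?_
    intro x hx hxP
    have h5 := hm x (by simp [hxP])
    have h6 := hP'.nodup
    have h7 := hl x hx
    grind
  obtain ⟨Q, hQ⟩ : ∃ Q, l₁ ++ L.prev :: P' = Q ++ [L.next] := by
    have h5 := List.getLast?_eq_some_iff.1 e1.2.1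
    exact h5
  rw [hQ] at e1 ⊢
  have e2 : IsPath G.graph.Adj L.next G.output (L.next :: l₃) := by
    have : IsPath G.graph.Adj G.input G.output ((l₁ ++ L.prev :: l₂) ++ L.next :: l₃) := by
      have hS0 : IsPath G.graph.Adj G.input G.output (l₁ ++ L.prev :: (l₂ ++ L.next :: l₃)) := hS
      simpa using hS0
    exact this.right
  have : IsPath G.graph.Adj G.input G.output (Q ++ L.next :: l₃) := by
    refine e1.append e2 ?_
    intro x hx hx3
    have h5 := hr x hx3
    have h6 : x ∈ l₁ ++ L.prev :: P' := by rw [hQ]; simp [hx]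
    have h7 := hm x
    grind
  have h8 : G.IsIOPath (Q ++ L.next :: l₃) := this
  simpa using h8

theorem isSimple_of_isPath_localArrow (hP : IsPath L.LocalArrow L.prev L.next P) (hv : v ∈ P) :
    G.IsSimple v := by
  obtain ⟨S, hS, -⟩ := L.prev_superSimple.1
  obtain ⟨l₁, l₂, l₃, rfl, h₁, -, h₃⟩ := L.exists_split hS
  exact ⟨_, isIOPath_glue hS h₁ h₃ hP, by simp [hv]⟩

theorem mem_middle_of_complementComponent {w : V} (hS : G.IsIOPath S) (hw : w ∈ L.middle)
    (hv : ReflTransGen (G.ComplementArrow S) w v) (hv' : ReflTransGen (G.ComplementArrow S) v w) :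
    v ∈ L.middle :=
  ⟨mem_before_of_complement hw.1 (L.next_superSimple.2 S hS) hv,
    mem_after_of_complement hw.2 (L.prev_superSimple.2 S hS) hv'⟩

/-- The further conditions on linked appendage nodes hold for every appendage node whose transitive
component meets the simple subnetwork. -/
theorem mem_linked (ha : G.IsAppendage a) (hS : G.IsIOPath S) {w : V}
    (hw : w ∈ G.complementComponent S a) (hwL : w ∈ L.simpleSubnetwork) : a ∈ L.linked := by
  have key : ∀ v ∈ G.complementComponent S a, G.IsAppendage v → ¬ G.IsSuperAppendage v := by
    intro v hv hva hvs
    exact hvs.2 S hS hv.1 w ⟨hw.1, hv.2.2.trans hw.2.1, hw.2.2.trans hv.2.1⟩ hwL.1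
  have haS : a ∉ S := fun h => ha ⟨S, hS, h⟩
  refine ⟨ha, key a ⟨haS, .refl, .refl⟩ ha, S, hS, haS, ⟨w, hw, hwL⟩, ?_⟩
  intro v hv
  by_cases hvs : G.IsSimple v
  · refine .inl (.inr (mem_simpleSubnetwork_iff.2 ⟨hvs, ?_⟩))
    exact mem_middle_of_complementComponent hS (mem_simpleSubnetwork_iff.1 hwL).2
      (hw.2.2.trans hv.2.1) (hv.2.2.trans hw.2.1)
  · exact .inr ⟨hvs, key v hv hvs⟩

/-- The augmented simple subnetwork consists of all nodes between the two super-simple nodes. That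
every appendage node between them is linked is where Menger's theorem enters. -/
theorem augmented_eq_middle : L.augmented = L.middle := by
  apply Set.Subset.antisymm
  · rintro v (hv | ⟨-, -, S, hS, -, ⟨w, hw, hwL⟩, -⟩)
    · exact (mem_simpleSubnetwork_iff.1 hv).2
    · exact mem_middle_of_complementComponent hS (mem_simpleSubnetwork_iff.1 hwL).2 hw.2.2 hw.2.1
  · intro a ha
    by_cases hs : G.IsSimple a
    · exact .inl (mem_simpleSubnetwork_iff.2 ⟨hs, ha⟩)
    right
    obtain ⟨P, hP, h⟩ := exists_path_mem_or_component_meets (r := L.LocalArrow) (a := a)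
      prev_ne_next
      (fun x h => h.2.2.elim prev_not_mem_middle prev_ne_next)
      (fun x h => h.2.1.elim next_not_mem_middle fun e => prev_ne_next e.symm)
      (fun q h1 h2 => exists_isPath_localArrow_not_mem h1 h2)
      (reflTransGen_prev ha) (reflTransGen_next ha)
    rcases h with h | ⟨w, l, hl, hwl, hwP, haw, hwa⟩
    · exact absurd (isSimple_of_isPath_localArrow hP h) hs
    obtain ⟨S, hS, -⟩ := L.prev_superSimple.1
    obtain ⟨l₁, l₂, l₃, rfl, h₁, -, h₃⟩ := L.exists_split hS
    have hS' := isIOPath_glue hS h₁ h₃ hP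
    have hoff : ∀ x, x ∈ L.middle → x ∉ P → x ∉ l₁ ++ P ++ l₃ := by
      intro x hx hxP
      simp only [List.mem_append, not_or]
      exact ⟨⟨fun h => L.prev_superSimple.not_mem_after (h₁ x h) hx.2, hxP⟩,
        fun h => L.next_superSimple.not_mem_after hx.1 (h₃ x h)⟩
    have hpP := hP.left_mem
    have hnP := hP.right_mem
    have hlift : ∀ x y, L.LocalArrow x y ∧ x ∉ P ∧ y ∉ P →
        G.ComplementArrow (l₁ ++ P ++ l₃) x y := by
      rintro x y ⟨⟨h1, h2, h3⟩, hx, hy⟩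
      refine ⟨hoff x ?_ hx, hoff y ?_ hy, h1⟩
      · exact h2.resolve_right fun e => hx (e ▸ hpP)
      · exact h3.resolve_right fun e => hy (e ▸ hnP)
    have hwm : w ∈ L.middle := by
      rcases isPath_localArrow_forall_mem hl w hwl with h | h | h
      · exact h
      · exact absurd (h ▸ hpP) hwP
      · exact absurd (h ▸ hnP) hwP
    exact mem_linked hs hS' (w := w) ⟨hoff w hwm hwP, haw.lift id hlift, hwa.lift id hlift⟩
      (mem_simpleSubnetwork_iff.2 ⟨isSimple_of_isPath_localArrow hl hwl, hwm⟩)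

theorem structural_eq : L.structural = {L.prev} ∪ L.middle ∪ {L.next} := by
  rw [structural, augmented_eq_middle]

end BackboneNode

/-! ### Downstream nodes of the structural pattern network -/

variable {V : Type*} {G : IONetwork V}

/-- The super-simple node where a node of the pattern network starts. -/
def PatternNode.start : G.PatternNode → V
  | .superSimple ρ _ => ρ
  | .backbone M => M.prev

theorem exists_backbone_next [Finite V] {a b : V} (ha : G.IsSuperSimple a)
    (hb : G.IsSuperSimple b) (hab : a ∈ G.before b) :
    ∃ M : G.BackboneNode, M.next = b ∧ M.prev ∉ G.before a := by
  obtain ⟨c, ⟨hc, hcb⟩, hmax⟩ := Set.exists_max_image {c | G.IsSuperSimple c ∧ c ∈ G.before b}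
    (fun c => (G.before c).ncard) (Set.toFinite _) ⟨a, ha, hab⟩
  have hlt : ∀ x y, G.IsSuperSimple x → G.IsSuperSimple y → x ∈ G.before y →
      (G.before x).ncard < (G.before y).ncard := fun x y hx hy hxy =>
    Set.ncard_lt_ncard ⟨hx.before_subset hy hxy, fun h => not_mem_before_self (h hxy)⟩
  refine ⟨⟨c, b, hc, hb, hc.1.precedes_of_mem_before hb hcb, ?_⟩, rfl, ?_⟩
  · rintro d hd ⟨h1, h2⟩
    exact absurd (hmax d ⟨hd, h2.mem_before⟩) (not_le.2 (hlt c d hc hd h1.mem_before))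
  · intro h
    exact absurd (hmax a ⟨ha, hab⟩) (not_le.2 (hlt c a hc ha h))

theorem strictlyDownstream_superSimple [Finite V] (L : G.BackboneNode) (n : ℕ) :
    ∀ ρ (h : G.IsSuperSimple ρ), (G.before ρ).ncard = n → ρ ∉ G.before L.next →
      G.StrictlyDownstream (.backbone L) (.superSimple ρ h) := by
  induction n using Nat.strong_induction_on with
  | _ n ih =>
  intro ρ h hn hρ
  by_cases hρL : ρ = L.next
  · subst hρL
    exact .single (.out L)
  · have h1 := (h.mem_before_or_after L.next_superSimple hρL).resolve_left hρ
    obtain ⟨M, rfl, hM⟩ := exists_backbone_next L.next_superSimple h h1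
    have h2 : (G.before M.prev).ncard < n := by
      rw [← hn]
      exact Set.ncard_lt_ncard ⟨M.prev_superSimple.before_subset M.next_superSimple
        BackboneNode.prev_mem_before, fun h => not_mem_before_self (h BackboneNode.prev_mem_before)⟩
    exact ((ih _ h2 M.prev M.prev_superSimple rfl hM).tail (.into M)).tail (.out M)

theorem strictlyDownstream_iff [Finite V] (L : G.BackboneNode) (v : G.PatternNode) :
    G.StrictlyDownstream (.backbone L) v ↔ v.start ∉ G.before L.next := by
  constructor
  · intro h
    induction h with
    | single h =>
      cases h
      exact not_mem_before_self
    | @tail b c _ hbc ih =>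
      cases hbc with
      | into M => exact ih
      | out M =>
        intro h
        exact ih (M.next_superSimple.before_subset L.next_superSimple h
          BackboneNode.prev_mem_before)
  · intro h
    cases v with
    | superSimple ρ hρ => exact strictlyDownstream_superSimple L _ ρ hρ rfl h
    | backbone M =>
      exact (strictlyDownstream_superSimple L _ M.prev M.prev_superSimple rfl h).tail (.into M)

/-- A structural subnetwork that starts at or after `L.next` contains no node before `L.next`. -/
theorem BackboneNode.not_mem_before_of_mem_structural {L M : G.BackboneNode}
    (h : M.prev ∉ G.before L.next) {κ : V} (hκ : κ ∈ M.structural) : κ ∉ G.before L.next := by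
  rw [structural_eq] at hκ
  rcases hκ with (rfl | hκ) | rfl
  · exact h
  · intro hκL
    by_cases he : M.prev = L.next
    · exact L.next_superSimple.not_mem_after hκL (he ▸ hκ.2)
    · have h1 := (M.prev_superSimple.mem_before_or_after L.next_superSimple he).resolve_left h
      exact M.prev_superSimple.not_mem_after
        (L.next_superSimple.before_subset M.prev_superSimple h1 hκL) hκ.2
  · intro hκL
    exact h (M.next_superSimple.before_subset L.next_superSimple hκL prev_mem_before)

end IONetwork

end Structural

/-! ### Singular homeostasis blocks -/

section LinearAlgebra

namespace IONetwork

variable {V : Type*} [Fintype V] [DecidableEq V]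

open Classical in
/-- A homeostasis matrix is singular if and only if some nonzero vector that lives on the nodes other
than the output node `b` solves the equations of the nodes other than the input node `a`. -/
theorem det_homeostasisMatrix_eq_zero_iff (J : Matrix V V ℝ) {K : Set V} {a b : V} (hab : a ≠ b)
    (ha : a ∈ K) (hb : b ∈ K) : (homeostasisMatrix J K a b).det = 0 ↔
      ∃ y : V → ℝ, y ≠ 0 ∧ (∀ v, y v ≠ 0 → v ∈ K ∧ v ≠ b) ∧ ∀ k ∈ K, k ≠ a → (J *ᵥ y) k = 0 := by
  let e : {v // v ∈ K ∧ v ≠ a} → V := fun c => if (c : V) = b then a else c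
  have he : Function.Injective e := by
    rintro ⟨c, hc, hca⟩ ⟨d, hd, hda⟩ h
    simp only [e] at h
    split_ifs at h with h1 h2 h2
    · simp [h1, h2]
    · exact absurd h.symm hda
    · exact absurd h hca
    · simpa using h
  have hrange : ∀ v, v ∈ K ∧ v ≠ b → v ∈ Set.range e := by
    rintro v ⟨hv, hvb⟩
    by_cases hva : v = a
    · exact ⟨⟨b, hb, hab.symm⟩, by simp [e, hva]⟩
    · exact ⟨⟨v, hv, hva⟩, by simp [e, hvb]⟩
  have heK : ∀ c, e c ∈ K ∧ e c ≠ b := by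
    rintro ⟨c, hc, hca⟩
    simp only [e]
    split_ifs with h1
    · exact ⟨ha, hab⟩
    · exact ⟨hc, h1⟩
  have hmul : ∀ (u : {v // v ∈ K ∧ v ≠ a} → ℝ) (y : V → ℝ), (∀ c, y (e c) = u c) →
      (∀ v, v ∉ Set.range e → y v = 0) → ∀ r, (homeostasisMatrix J K a b *ᵥ u) r = (J *ᵥ y) r := by
    intro u y h1 h2 r
    simp only [Matrix.mulVec, dotProduct]
    refine Fintype.sum_of_injective e he _ _ (fun v hv => by rw [h2 v hv, mul_zero]) fun c => ?_
    rw [h1]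
    rfl
  rw [← Matrix.exists_mulVec_eq_zero_iff]
  constructor
  · rintro ⟨u, hu, h⟩
    refine ⟨Function.extend e u 0, ?_, ?_, ?_⟩
    · intro h0
      apply hu
      ext c
      rw [← he.extend_apply u 0 c, h0]
      rfl
    · intro v hv
      by_cases hr : v ∈ Set.range e
      · obtain ⟨c, rfl⟩ := hr
        exact heK c
      · exact absurd (Function.extend_apply' _ _ _ hr) hv
    · intro k hk hka
      rw [← hmul u (Function.extend e u 0) (fun c => he.extend_apply _ _ _)
        (fun v hv => Function.extend_apply' _ _ _ hv) ⟨k, hk, hka⟩, h]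
      rfl
  · rintro ⟨y, hy, hsupp, h⟩
    have hy0 : ∀ v, v ∉ Set.range e → y v = 0 := fun v hv => by
      by_contra h0
      exact hv (hrange v (hsupp v h0))
    refine ⟨fun c => y (e c), ?_, ?_⟩
    · intro h0
      apply hy
      ext v
      by_cases hr : v ∈ Set.range e
      · obtain ⟨c, rfl⟩ := hr
        exact congrFun h0 c
      · exact hy0 v hr
    · ext r
      rw [hmul _ y (fun _ => rfl) hy0]
      exact h r r.2.1 r.2.2

variable {G : IONetwork V} (L : G.BackboneNode)

theorem BackboneNode.blockDet_eq_zero_iff (f : (V → ℝ) × ℝ → (V → ℝ)) (p : (V → ℝ) × ℝ) :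
    L.blockDet f p = 0 ↔ ∃ y : V → ℝ, y ≠ 0 ∧ (∀ v, y v ≠ 0 → v ∈ L.middle ∨ v = L.prev) ∧
      ∀ k, k ∈ L.middle ∨ k = L.next → (jacobian f p *ᵥ y) k = 0 := by
  rw [blockDet, det_homeostasisMatrix_eq_zero_iff _ prev_ne_next (by simp [structural_eq])
    (by simp [structural_eq])]
  have h1 : ∀ v, (v ∈ L.structural ∧ v ≠ L.next) ↔ (v ∈ L.middle ∨ v = L.prev) := by
    intro v
    have h2 : v = L.next → v ∉ L.middle := by rintro rfl; exact next_not_mem_middle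
    have h3 : v = L.prev → v ≠ L.next := by rintro rfl; exact prev_ne_next
    simp only [structural_eq, Set.mem_union, Set.mem_singleton_iff]
    tauto
  have h4 : ∀ v, (v ∈ L.structural ∧ v ≠ L.prev) ↔ (v ∈ L.middle ∨ v = L.next) := by
    intro v
    have h2 : v = L.prev → v ∉ L.middle := by rintro rfl; exact prev_not_mem_middle
    have h3 : v = L.next → v ≠ L.prev := by rintro rfl; exact prev_ne_next.symm
    simp only [structural_eq, Set.mem_union, Set.mem_singleton_iff]
    tauto
  simp only [h1, ← and_imp, h4]

/-- If the homeostasis block is singular, some nonzero vector that lives before `next` solves all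
equations but the one of the input node. The unknowns are a kernel vector of the block, up to a
factor, and the values on the nodes of `C`; these outnumber the remaining equations. -/
theorem BackboneNode.exists_vector_before (J : Matrix V V ℝ)
    (hJ : ∀ j l, l ≠ j → ¬ G.graph.Adj l j → J j l = 0) {u : V → ℝ} (hu0 : u ≠ 0)
    (hu : ∀ v, u v ≠ 0 → v ∈ L.middle ∨ v = L.prev)
    (hJu : ∀ k, k ∈ L.middle ∨ k = L.next → (J *ᵥ u) k = 0) :
    ∃ y : V → ℝ, y ≠ 0 ∧ (∀ v, v ∉ G.before L.next → y v = 0) ∧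
      ∀ k, k ≠ G.input → (J *ᵥ y) k = 0 := by
  classical
  -- the nodes before `next` outside of the structural subnetwork
  let C : Finset V := Finset.univ.filter fun v =>
    v ∈ G.before L.next ∧ v ∉ G.after L.prev ∧ v ≠ L.prev
  let R : Finset V := (insert L.prev C).erase G.input
  have hprevC : L.prev ∉ C := by simp [C]
  have hinput : G.input ∈ insert L.prev C := by
    have h1 : G.input ∈ G.before L.next :=
      ⟨input_ne_of_mem_before prev_mem_before, .refl⟩
    by_cases h : G.input = L.prev
    · simp [h]
    · have h2 : G.input ∉ G.after L.prev :=
        L.prev_superSimple.not_mem_after ⟨h, .refl⟩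
      simp [C, h1, h2, h]
  have hcard : R.card = C.card := by
    rw [Finset.card_erase_of_mem hinput, Finset.card_insert_of_notMem hprevC]
    rfl
  let E : (C → ℝ) × ℝ →ₗ[ℝ] (V → ℝ) :=
    { toFun := fun q v => (if h : v ∈ C then q.1 ⟨v, h⟩ else 0) + q.2 * u v
      map_add' := by
        intro q q'
        ext v
        by_cases h : v ∈ C <;> simp [h] <;> ring
      map_smul' := by
        intro c q
        ext v
        by_cases h : v ∈ C <;> simp [h] <;> ring }
  let Φ : (C → ℝ) × ℝ →ₗ[ℝ] (R → ℝ) :=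
    (LinearMap.funLeft ℝ ℝ ((↑) : R → V)).comp ((Matrix.mulVecLin J).comp E)
  have hker : LinearMap.ker Φ ≠ ⊥ := by
    apply LinearMap.ker_ne_bot_of_finrank_lt
    simp [hcard]
  obtain ⟨⟨z, c⟩, hq, hq0⟩ := (Submodule.ne_bot_iff _).1 hker
  have hR : ∀ k ∈ R, (J *ᵥ E (z, c)) k = 0 := fun k hk => congrFun hq ⟨k, hk⟩
  have huC : ∀ v ∈ C, u v = 0 := by
    intro v hv
    by_contra h
    simp only [C, Finset.mem_filter] at hv
    rcases hu v h with h1 | h1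
    · exact hv.2.2.1 h1.2
    · exact hv.2.2.2 h1
  have hbefore : ∀ v, v ∉ G.before L.next → E (z, c) v = 0 := by
    intro v hv
    have h1 : v ∉ C := by simp [C, hv]
    have h2 : u v = 0 := by
      by_contra h
      rcases hu v h with h1 | h1
      · exact hv h1.1
      · exact hv (h1 ▸ prev_mem_before)
    simp [E, h1, h2]
  refine ⟨E (z, c), ?_, hbefore, ?_⟩
  · intro h0
    have hz : z = 0 := by
      ext ⟨v, hv⟩
      have := congrFun h0 v
      simpa [E, hv, huC v hv] using this
    subst hz
    apply hq0
    obtain ⟨v, hv⟩ := Function.ne_iff.1 hu0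
    have := congrFun h0 v
    have hc : c = 0 := by simpa [E, hv, show u v ≠ 0 from hv] using this
    rw [hc]
    rfl
  · intro k hk
    by_cases hkR : k ∈ R
    · exact hR k hkR
    have hkC : k ∉ C ∧ k ≠ L.prev := by
      simp only [R, Finset.mem_erase, Finset.mem_insert] at hkR
      tauto
    by_cases hkM : k ∈ L.middle ∨ k = L.next
    · have hka : k ∈ G.after L.prev := hkM.elim (fun h => h.2) fun h => h ▸ next_mem_after
      have h1 : (J *ᵥ E (z, c)) k = c * (J *ᵥ u) k := by
        simp only [Matrix.mulVec, dotProduct, Finset.mul_sum]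
        refine Finset.sum_congr rfl fun v _ => ?_
        by_cases hv : v ∈ C
        · have hvC := hv
          simp only [C, Finset.mem_filter] at hv
          have : J k v = 0 := by
            refine hJ k v (fun e => hkC.1 (e ▸ hvC)) fun h => hv.2.2.1 ?_
            exact mem_after_of_adj hka h hv.2.2.2
          simp [this]
        · simp [E, hv]
          ring
      rw [h1, hJu k hkM, mul_zero]
    · have hkb : k ∉ G.before L.next := by
        intro h
        by_cases h2 : k ∈ G.after L.prev
        · exact hkM (.inl ⟨h, h2⟩)
        · exact hkC.1 (by simp [C, h, h2, hkC.2])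
      simp only [Matrix.mulVec, dotProduct]
      refine Finset.sum_eq_zero fun v _ => ?_
      by_cases hv : v ∈ G.before L.next
      · rw [hJ k v (fun e => hkb (e ▸ hv)) fun h => hkb
          (mem_before_of_adj hv h fun e => hkM (.inr e)), zero_mul]
      · rw [hbefore v hv, mul_zero]

/-- If the homeostasis block is singular but the Jacobian is not, the response to a perturbation of
the input node vanishes on all nodes that are not before `next`. -/
theorem BackboneNode.eq_zero_of_blockDet_eq_zero {f : (V → ℝ) × ℝ → (V → ℝ)} {p : (V → ℝ) × ℝ}
    (hJ : ∀ j l, l ≠ j → ¬ G.graph.Adj l j → jacobian f p j l = 0) (hdet : (jacobian f p).det ≠ 0)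
    (hB : L.blockDet f p = 0) {x : V → ℝ} (hx : ∀ k, k ≠ G.input → (jacobian f p *ᵥ x) k = 0)
    {κ : V} (hκ : κ ∉ G.before L.next) : x κ = 0 := by
  obtain ⟨u, hu0, hu, hJu⟩ := (L.blockDet_eq_zero_iff f p).1 hB
  obtain ⟨y, hy0, hy, hJy⟩ := L.exists_vector_before _ hJ hu0 hu hJu
  have hinj : ∀ z, jacobian f p *ᵥ z = 0 → z = 0 := fun z hz =>
    Matrix.eq_zero_of_mulVec_eq_zero hdet hz
  have hd : (jacobian f p *ᵥ y) G.input ≠ 0 := by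
    intro h
    apply hy0
    apply hinj
    ext k
    by_cases hk : k = G.input
    · rw [hk, h]; rfl
    · exact hJy k hk
  have h1 := hinj ((jacobian f p *ᵥ y) G.input • x - (jacobian f p *ᵥ x) G.input • y) (by
    rw [Matrix.mulVec_sub, Matrix.mulVec_smul, Matrix.mulVec_smul]
    ext k
    by_cases hk : k = G.input
    · subst hk
      simp [mul_comm]
    · simp [hx k hk, hJy k hk])
  have h2 := congrFun h1 κ
  simpa [hy κ hκ, hd] using h2

end IONetwork

end LinearAlgebra

/-! ### Branches of equilibria -/

section Branches

namespace IONetwork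

variable {V : Type*} [Fintype V] [DecidableEq V] {G : IONetwork V} {f : (V → ℝ) × ℝ → (V → ℝ)}
  {p : (V → ℝ) × ℝ}

theorem fderiv_apply_eq (f : (V → ℝ) × ℝ → (V → ℝ)) (p : (V → ℝ) × ℝ) (y : V → ℝ) (c : ℝ) :
    fderiv ℝ f p (y, c) = jacobian f p *ᵥ y + c • fderiv ℝ f p (0, 1) := by
  have h1 : ((y, c) : (V → ℝ) × ℝ) =
      ∑ l, y l • ((Pi.single l 1, 0) : (V → ℝ) × ℝ) + c • ((0, 1) : (V → ℝ) × ℝ) := by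
    refine Prod.ext ?_ ?_
    · ext v
      simp [Prod.fst_sum, Finset.sum_apply, Pi.single_apply]
    · simp [Prod.snd_sum]
  rw [h1, map_add, map_sum, map_smul]
  simp only [map_smul]
  congr 1
  ext j
  simp only [Finset.sum_apply, Pi.smul_apply, smul_eq_mul, Matrix.mulVec, dotProduct, jacobian,
    Matrix.of_apply, mul_comm]

theorem IsAdmissible.differentiableAt (hf : G.IsAdmissible f) : DifferentiableAt ℝ f p :=
  hf.1.contDiffAt.differentiableAt (by simp)

theorem IsAdmissible.jacobian_eq_zero (hf : G.IsAdmissible f) {j l : V} (h1 : l ≠ j)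
    (h2 : ¬ G.graph.Adj l j) : jacobian f p j l = 0 :=
  (hf.2.1 j l).2 (by tauto) p

/-- Only the equation of the input node depends on the input parameter. -/
theorem IsAdmissible.fderiv_parameter (hf : G.IsAdmissible f) {k : V} (hk : k ≠ G.input) :
    fderiv ℝ f p (0, 1) k = 0 := by
  have h1 : HasDerivAt (fun I : ℝ => ((p.1, I) : (V → ℝ) × ℝ)) (0, 1) p.2 :=
    (hasDerivAt_const _ _).prodMk (hasDerivAt_id _)
  have h2 : HasDerivAt (fun I : ℝ => f (p.1, I)) (fderiv ℝ f p (0, 1)) p.2 :=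
    HasFDerivAt.comp_hasDerivAt p.2 hf.differentiableAt.hasFDerivAt h1
  have h3 := hasDerivAt_pi.1 h2 k
  have h4 : (fun I : ℝ => f (p.1, I) k) = fun _ => f (p.1, p.2) k := by
    ext I
    exact hf.2.2 k hk _ _ _
  rw [h4] at h3
  exact h3.unique (hasDerivAt_const _ _)

/-- Implicit differentiation along a branch of equilibria. -/
theorem jacobian_mulVec_deriv (hf : G.IsAdmissible f) {X : ℝ → V → ℝ} {I₀ : ℝ}
    (hX : ContDiffAt ℝ ∞ X I₀) (h0 : ∀ᶠ I in 𝓝 I₀, f (X I, I) = 0) :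
    jacobian f (X I₀, I₀) *ᵥ deriv X I₀ = - fderiv ℝ f (X I₀, I₀) (0, 1) := by
  have h1 : HasDerivAt X (deriv X I₀) I₀ := (hX.differentiableAt (by simp)).hasDerivAt
  have h2 : HasDerivAt (fun I => ((X I, I) : (V → ℝ) × ℝ)) (deriv X I₀, 1) I₀ :=
    h1.prodMk (hasDerivAt_id _)
  have h3 : HasDerivAt (fun I => f (X I, I)) (fderiv ℝ f (X I₀, I₀) (deriv X I₀, 1)) I₀ :=
    HasFDerivAt.comp_hasDerivAt I₀ hf.differentiableAt.hasFDerivAt h2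
  have h4 : HasDerivAt (fun I => f (X I, I)) 0 I₀ :=
    (hasDerivAt_const I₀ (0 : V → ℝ)).congr_of_eventuallyEq h0
  have h5 := h3.unique h4
  rw [fderiv_apply_eq, one_smul] at h5
  exact eq_neg_of_add_eq_zero_left h5

theorem deriv_component {X : ℝ → V → ℝ} {I₀ : ℝ} (hX : ContDiffAt ℝ ∞ X I₀) (κ : V) :
    deriv (fun I => X I κ) I₀ = deriv X I₀ κ :=
  (hasDerivAt_pi.1 (hX.differentiableAt (by simp)).hasDerivAt κ).deriv

theorem IsHyperbolicEquilibrium.det_ne_zero {X₀ : V → ℝ} {I₀ : ℝ}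
    (h : IsHyperbolicEquilibrium f X₀ I₀) : (jacobian f (X₀, I₀)).det ≠ 0 := by
  intro h0
  refine h.2 0 ?_ rfl
  rw [spectrum.zero_mem_iff, Matrix.isUnit_iff_isUnit_det, ← RingHom.mapMatrix_apply,
    ← RingHom.map_det, h0]
  simp

/-- Homeostasis induction downstream holds without any genericity. -/
theorem BackboneNode.inducesNode_of_not_mem_before (L : G.BackboneNode) {κ : V}
    (hκ : κ ∉ G.before L.next) : L.InducesNode κ := by
  refine Eventually.of_forall fun f X₀ I₀ hyp ho hB => ?_
  obtain ⟨X, rfl, hX, h0, -⟩ := ho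
  refine ⟨X, rfl, hX, h0, ?_⟩
  rw [deriv_component hX]
  refine L.eq_zero_of_blockDet_eq_zero (fun j l h1 h2 => f.2.jacobian_eq_zero h1 h2)
    hyp.det_ne_zero hB (fun k hk => ?_) hκ
  rw [jacobian_mulVec_deriv f.2 hX h0, Pi.neg_apply, f.2.fderiv_parameter hk, neg_zero]

end IONetwork

end Branches

/-! ### The space of admissible families -/

section FamilySpace

/-- That `g' t` is the derivative of `g t` is a closed condition on `t`, for the compact-open
topology. -/
theorem isClosed_setOf_hasFDerivAt {T E F : Type*} [TopologicalSpace T] [NormedAddCommGroup E]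
    [NormedSpace ℝ E] [WeaklyLocallyCompactSpace E] [NormedAddCommGroup F] [NormedSpace ℝ F]
    {g : T → C(E, F)} {g' : T → C(E, E →L[ℝ] F)} (hg : Continuous g) (hg' : Continuous g') :
    IsClosed {t | ∀ x, HasFDerivAt (g t) (g' t x) x} := by
  rw [isClosed_iff_forall_filter]
  intro t l hl hls hlt x
  have h1 : Tendsto g' l (𝓝 (g' t)) := (hg'.tendsto t).mono_left hlt
  have h2 : Tendsto g l (𝓝 (g t)) := (hg.tendsto t).mono_left hlt
  refine hasFDerivAt_of_tendstoUniformlyOnFilter (l := l) (f := fun s => g s)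
    (f' := fun s x => g' s x) ?_ ?_ ?_
  · exact tendstoLocallyUniformly_iff_filter.1
      (ContinuousMap.tendsto_iff_tendstoLocallyUniformly.1 h1) x
  · have : ∀ᶠ s in l, ∀ x, HasFDerivAt (g s) (g' s x) x := hls (mem_principal_self _)
    filter_upwards [this.prod_inl (𝓝 x)] with q hq
    exact hq q.2
  · exact Eventually.of_forall fun y =>
      ((ContinuousEvalConst.continuous_eval_const y).tendsto _).comp h2

theorem isCompletelyMetrizableSpace_continuousMap {E F : Type*} [NormedAddCommGroup E]
    [NormedSpace ℝ E] [ProperSpace E] [NormedAddCommGroup F] [CompleteSpace F] :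
    TopologicalSpace.IsCompletelyMetrizableSpace C(E, F) := by
  have : TopologicalSpace.MetrizableSpace C(E, F) := inferInstance
  exact inferInstance

namespace IONetwork

variable {V : Type*} [Fintype V] [DecidableEq V] {G : IONetwork V}

namespace AdmissibleFamily

/-- All derivatives of an admissible family. -/
noncomputable def jets (f : G.AdmissibleFamily) (n : ℕ) :
    C((V → ℝ) × ℝ, ((V → ℝ) × ℝ) [×n]→L[ℝ] (V → ℝ)) :=
  iteratedDerivative n f

theorem isInducing_jets : IsInducing (jets (G := G)) := by
  refine ⟨?_⟩
  rw [induced_to_pi]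
  rfl

theorem continuous_iteratedDerivative (n : ℕ) :
    Continuous (iteratedDerivative (G := G) n) :=
  (continuous_apply n).comp isInducing_jets.continuous

theorem jets_zero_apply (f : G.AdmissibleFamily) (p) (m : Fin 0 → (V → ℝ) × ℝ) :
    jets f 0 p m = f.1 p :=
  iteratedFDeriv_zero_apply _

theorem jets_one_apply (f : G.AdmissibleFamily) (p) (m : Fin 1 → (V → ℝ) × ℝ) :
    jets f 1 p m = fderiv ℝ f.1 p (m 0) :=
  iteratedFDeriv_one_apply _

theorem injective_jets : Function.Injective (jets (G := G)) := by
  intro f g h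
  apply Subtype.ext
  ext1 p
  rw [← jets_zero_apply f p 0, ← jets_zero_apply g p 0, h]

variable (G) in
/-- The closed conditions on the derivatives of an admissible family. -/
def closedConditions : Set (∀ n, C((V → ℝ) × ℝ, ((V → ℝ) × ℝ) [×n]→L[ℝ] (V → ℝ))) :=
  {p | (∀ m x, HasFDerivAt (p m) (p (m + 1) x).curryLeft x) ∧
    (∀ j l, ¬ (l = j ∨ G.graph.Adj l j) → ∀ x, p 1 x (fun _ => (Pi.single l 1, 0)) j = 0) ∧
    ∀ j, j ≠ G.input → ∀ X I I', p 0 (X, I) 0 j = p 0 (X, I') 0 j}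

variable (G) in
/-- The open conditions on the derivatives of an admissible family. -/
def openConditions : Set (∀ n, C((V → ℝ) × ℝ, ((V → ℝ) × ℝ) [×n]→L[ℝ] (V → ℝ))) :=
  {p | ∀ j l, (l = j ∨ G.graph.Adj l j) → ∃ x, p 1 x (fun _ => (Pi.single l 1, 0)) j ≠ 0}

theorem continuous_jet_component (n : ℕ) (x : (V → ℝ) × ℝ) (m : Fin n → (V → ℝ) × ℝ) (j : V) :
    Continuous fun p : ∀ n, C((V → ℝ) × ℝ, ((V → ℝ) × ℝ) [×n]→L[ℝ] (V → ℝ)) => p n x m j := by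
  have h1 : Continuous fun p : ∀ n, C((V → ℝ) × ℝ, ((V → ℝ) × ℝ) [×n]→L[ℝ] (V → ℝ)) => p n x :=
    (ContinuousEvalConst.continuous_eval_const x).comp (continuous_apply n)
  exact (continuous_apply j).comp ((ContinuousEvalConst.continuous_eval_const m).comp h1)

theorem isClosed_closedConditions : IsClosed (closedConditions G) := by
  have h := fun m => isClosed_setOf_hasFDerivAt
    (T := ∀ n, C((V → ℝ) × ℝ, ((V → ℝ) × ℝ) [×n]→L[ℝ] (V → ℝ))) (g := fun p => p m)
    (g' := fun p => (⟨_, (continuousMultilinearCurryLeftEquiv ℝ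
      (fun _ : Fin (m + 1) => (V → ℝ) × ℝ) (V → ℝ)).continuous⟩ : C(_, _)).comp (p (m + 1)))
    (continuous_apply m) ((ContinuousMap.continuous_postcomp _).comp (continuous_apply (m + 1)))
  simp only [closedConditions, Set.ofPred_and]
  rw [Set.ofPred_forall]
  refine (isClosed_iInter h).inter (IsClosed.inter ?_ ?_)
  · simp only [Set.ofPred_forall]
    exact isClosed_iInter fun j => isClosed_iInter fun l => isClosed_iInter fun _ =>
      isClosed_iInter fun x => isClosed_eq (continuous_jet_component _ _ _ _) continuous_const
  · simp only [Set.ofPred_forall]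
    exact isClosed_iInter fun j => isClosed_iInter fun _ => isClosed_iInter fun X =>
      isClosed_iInter fun I => isClosed_iInter fun I' =>
        isClosed_eq (continuous_jet_component _ _ _ _) (continuous_jet_component _ _ _ _)

theorem isOpen_openConditions : IsOpen (openConditions G) := by
  simp only [openConditions, Set.ofPred_forall, Set.ofPred_exists]
  exact isOpen_iInter_of_finite fun j => isOpen_iInter_of_finite fun l =>
    isOpen_iInter_of_finite fun _ => isOpen_iUnion fun x =>
      isOpen_ne_fun (continuous_jet_component _ _ _ _) continuous_const

theorem range_jets : Set.range (jets (G := G)) = closedConditions G ∩ openConditions G := by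
  ext p
  constructor
  · rintro ⟨f, rfl⟩
    have h1 : ∀ (x) (j l : V), jets f 1 x (fun _ => (Pi.single l 1, 0)) j = jacobian f.1 x j l :=
      fun x j l => by rw [jets_one_apply]; rfl
    refine ⟨⟨fun m x => ?_, fun j l h x => ?_, fun j hj X I I' => ?_⟩, fun j l h => ?_⟩
    · have h2 := (contDiff_iff_ftaylorSeries.1 f.2.1).fderiv m
        (by exact_mod_cast WithTop.coe_lt_top (m : ℕ)) x
      exact h2
    · rw [h1]
      exact (f.2.2.1 j l).2 h x
    · rw [jets_zero_apply, jets_zero_apply]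
      exact f.2.2.2 j hj X I I'
    · simp only [h1]
      by_contra! h2
      exact (f.2.2.1 j l).1 h2 h
  · rintro ⟨⟨h1, h2, h3⟩, h4⟩
    let f : (V → ℝ) × ℝ → V → ℝ := fun x => p 0 x 0
    have hT : HasFTaylorSeriesUpTo ∞ f (fun x n => p n x) :=
      ⟨fun x => rfl, fun m _ x => h1 m x, fun m _ => (p m).continuous⟩
    have hf : ContDiff ℝ ∞ f := hT.contDiff
    have h5 : ∀ n x, p n x = iteratedFDeriv ℝ n f x := by
      intro n x
      have := (hasFTaylorSeriesUpToOn_univ_iff.2 hT).eq_iteratedFDerivWithin_of_uniqueDiffOn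
        (m := n) (by exact_mod_cast le_top) uniqueDiffOn_univ (Set.mem_univ x)
      rwa [iteratedFDerivWithin_univ] at this
    have h6 : ∀ (x) (j l : V), p 1 x (fun _ => (Pi.single l 1, 0)) j = jacobian f x j l :=
      fun x j l => by rw [h5, iteratedFDeriv_one_apply]; rfl
    refine ⟨⟨f, hf, fun j l => ⟨fun h hjl => ?_, fun h x => ?_⟩, fun j hj X I I' => h3 j hj X I I'⟩,
      ?_⟩
    · obtain ⟨x, hx⟩ := h4 j l hjl
      exact hx (by rw [h6, h])
    · rw [← h6]
      exact h2 j l h x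
    · ext1 n
      ext1 x
      exact (h5 n x).symm

/-- The admissible families are an open subset of a closed subset of the completely metrizable space
of all sequences of continuous maps that are candidates for the sequence of derivatives. -/
instance : BaireSpace G.AdmissibleFamily := by
  have h1 : ∀ n, TopologicalSpace.IsCompletelyMetrizableSpace
      C((V → ℝ) × ℝ, ((V → ℝ) × ℝ) [×n]→L[ℝ] (V → ℝ)) := fun n =>
    isCompletelyMetrizableSpace_continuousMap
  have : TopologicalSpace.IsCompletelyMetrizableSpace (closedConditions G) :=
    (isClosed_closedConditions (G := G)).isClosedEmbedding_subtypeVal.IsCompletelyMetrizableSpace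
  have hmem : ∀ f : G.AdmissibleFamily, jets f ∈ closedConditions G ∩ openConditions G := fun f =>
    range_jets (G := G) ▸ Set.mem_range_self f
  let ψ : G.AdmissibleFamily → closedConditions G := fun f => ⟨jets f, (hmem f).1⟩
  have hψ : IsOpenEmbedding ψ := by
    refine ⟨⟨?_, fun f g h => injective_jets (congrArg Subtype.val h)⟩, ?_⟩
    · have : IsInducing (Subtype.val ∘ ψ) := isInducing_jets
      exact IsInducing.subtypeVal.of_comp_iff.1 this
    · have : Set.range ψ = Subtype.val ⁻¹' openConditions G := by
        ext ⟨p, hp⟩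
        constructor
        · rintro ⟨f, hf⟩
          have h1 : jets f = p := congrArg Subtype.val hf
          exact h1 ▸ (hmem f).2
        · intro h
          obtain ⟨f, rfl⟩ : p ∈ Set.range (jets (G := G)) := range_jets (G := G) ▸ ⟨hp, h⟩
          exact ⟨f, rfl⟩
      rw [this]
      exact isOpen_openConditions.preimage continuous_subtype_val
  exact hψ.baireSpace

/-- The derivatives of an admissible family depend continuously on the family and the point. -/
theorem continuous_iteratedFDeriv (n : ℕ) : Continuous
    fun q : G.AdmissibleFamily × ((V → ℝ) × ℝ) => iteratedFDeriv ℝ n q.1.1 q.2 :=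
  ((continuous_iteratedDerivative n).comp continuous_fst).eval continuous_snd

theorem continuous_eval : Continuous
    fun q : G.AdmissibleFamily × ((V → ℝ) × ℝ) => q.1.1 q.2 :=
  ((continuousMultilinearCurryFin0 ℝ ((V → ℝ) × ℝ) (V → ℝ)).continuous).comp
    (continuous_iteratedFDeriv (G := G) 0)

theorem continuous_fderiv : Continuous
    fun q : G.AdmissibleFamily × ((V → ℝ) × ℝ) => fderiv ℝ q.1.1 q.2 := by
  have h := ((continuousMultilinearCurryFin1 ℝ ((V → ℝ) × ℝ) (V → ℝ)).continuous).comp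
    (continuous_iteratedFDeriv (G := G) 1)
  refine h.congr fun q => ContinuousLinearMap.ext fun v => ?_
  simp [iteratedFDeriv_one_apply]

theorem continuous_fderiv_fderiv : Continuous
    fun q : G.AdmissibleFamily × ((V → ℝ) × ℝ) => fderiv ℝ (fderiv ℝ q.1.1) q.2 := by
  have h := ((continuousMultilinearCurryLeftEquiv ℝ
    (fun _ : Fin 2 => (V → ℝ) × ℝ) (V → ℝ)).continuous).comp
    (continuous_iteratedFDeriv (G := G) 2)
  have h2 := (continuous_const (y :=
    (continuousMultilinearCurryFin1 ℝ ((V → ℝ) × ℝ)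
      (V → ℝ)).toContinuousLinearEquiv.toContinuousLinearMap)).clm_comp h
  refine h2.congr fun q => ContinuousLinearMap.ext fun v => ContinuousLinearMap.ext fun w => ?_
  simp [iteratedFDeriv_two_apply]

end AdmissibleFamily

end IONetwork

end FamilySpace

/-! ### Persistence of regular zeros -/

section Persistence

theorem exists_continuousLinearEquiv_of_injective {E : Type*} [NormedAddCommGroup E]
    [NormedSpace ℝ E] [FiniteDimensional ℝ E] (A : E →L[ℝ] E) (hA : ∀ y, A y = 0 → y = 0) :
    ∃ B : E ≃L[ℝ] E, (B : E →L[ℝ] E) = A := by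
  have hinj : Function.Injective (A : E →ₗ[ℝ] E) :=
    (injective_iff_map_eq_zero _).2 hA
  refine ⟨(LinearEquiv.ofInjectiveEndo (A : E →ₗ[ℝ] E) hinj).toContinuousLinearEquiv, ?_⟩
  ext y
  rfl

/-- A regular zero of a vector field persists under perturbations that are small together with their
first derivatives. -/
theorem eventually_exists_zero {T E : Type*} [TopologicalSpace T] [NormedAddCommGroup E]
    [NormedSpace ℝ E] [CompleteSpace E] [Nontrivial E] {F : T → E → E} {F' : T → E → E →L[ℝ] E}
    {t₀ : T} {p₀ : E} (hF : ∀ t p, HasFDerivAt (F t) (F' t p) p)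
    (hF' : ContinuousAt (fun q : T × E => F' q.1 q.2) (t₀, p₀))
    (hFc : ContinuousAt (fun t => F t p₀) t₀) (h₀ : F t₀ p₀ = 0) (A : E ≃L[ℝ] E)
    (hA : F' t₀ p₀ = A) {W : Set E} (hW : W ∈ 𝓝 p₀) :
    ∀ᶠ t in 𝓝 t₀, ∃ p ∈ W, F t p = 0 := by
  have hN : 0 < ‖(A.symm : E →L[ℝ] E)‖₊ := A.nnnorm_symm_pos
  set N : NNReal := ‖(A.symm : E →L[ℝ] E)‖₊ with hNdef
  set c : NNReal := N⁻¹ / 2 with hc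
  have hc0 : 0 < c := by positivity
  have h1 : ∀ᶠ q : T × E in 𝓝 (t₀, p₀), ‖F' q.1 q.2 - A‖ ≤ c := by
    have h2 : Tendsto (fun q : T × E => ‖F' q.1 q.2 - A‖) (𝓝 (t₀, p₀)) (𝓝 0) := by
      have := (hF'.sub (continuousAt_const (y := (A : E →L[ℝ] E)))).norm
      simpa [ContinuousAt, hA] using this
    exact (h2.eventually (gt_mem_nhds (show (0 : ℝ) < c by exact_mod_cast hc0))).mono
      fun q hq => hq.le
  rw [nhds_prod_eq] at h1
  obtain ⟨pt, hpt, pp, hpp, h2⟩ := eventually_prod_iff.1 h1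
  obtain ⟨r, hr, hrsub⟩ := Metric.nhds_basis_closedBall.mem_iff.1 (inter_mem hpp hW)
  have hgap : 0 < ((N : ℝ)⁻¹ - c) * r := by
    have : (N : ℝ)⁻¹ - c = (N : ℝ)⁻¹ / 2 := by rw [hc]; push_cast; ring
    rw [this]
    have : (0 : ℝ) < N := by exact_mod_cast hN
    positivity
  have h3 : ∀ᶠ t in 𝓝 t₀, ‖F t p₀‖ < ((N : ℝ)⁻¹ - c) * r := by
    have : Tendsto (fun t => ‖F t p₀‖) (𝓝 t₀) (𝓝 0) := by
      have := hFc.norm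
      simpa [ContinuousAt, h₀] using this
    exact this.eventually (gt_mem_nhds hgap)
  filter_upwards [hpt, h3] with t ht ht3
  have happ : ApproximatesLinearOn (F t) (A : E →L[ℝ] E) (Metric.closedBall p₀ r) c := by
    intro x hx y hy
    exact (convex_closedBall p₀ r).norm_image_sub_le_of_norm_hasFDerivWithin_le'
      (fun z _ => (hF t z).hasFDerivWithinAt) (fun z hz => h2 ht (hrsub hz).1) hy hx
  have hsurj := happ.surjOn_closedBall_of_nonlinearRightInverse A.toNonlinearRightInverse hr.le
    subset_rfl
  obtain ⟨p, hp, hp0⟩ := hsurj (show (0 : E) ∈ _ by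
    rw [mem_closedBall_iff_norm, zero_sub, norm_neg]
    exact ht3.le)
  exact ⟨p, (hrsub hp).2, hp0⟩

attribute [local instance] Matrix.linftyOpNormedRing Matrix.linftyOpNormedAlgebra

/-- Hyperbolicity is an open condition on matrices. -/
theorem eventually_spectrum_re_ne_zero {V : Type*} [Fintype V] [DecidableEq V] {M₀ : Matrix V V ℂ}
    (h : ∀ z ∈ spectrum ℂ M₀, z.re ≠ 0) : ∀ᶠ M in 𝓝 M₀, ∀ z ∈ spectrum ℂ M, z.re ≠ 0 := by
  set R : ℝ := (‖M₀‖ + 1) * ‖(1 : Matrix V V ℂ)‖ with hR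
  let K : Set ℂ := Metric.closedBall 0 R ∩ {z | z.re = 0}
  have hK : IsCompact K :=
    (isCompact_closedBall 0 R).inter_right (isClosed_eq Complex.continuous_re continuous_const)
  have hcont : Continuous fun q : Matrix V V ℂ × ℂ =>
      (algebraMap ℂ (Matrix V V ℂ) q.2 - q.1).det :=
    (((continuous_algebraMap ℂ (Matrix V V ℂ)).comp continuous_snd).sub continuous_fst).matrix_det
  have hspec : ∀ (M : Matrix V V ℂ) (z : ℂ),
      z ∈ spectrum ℂ M ↔ (algebraMap ℂ (Matrix V V ℂ) z - M).det = 0 := by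
    intro M z
    rw [spectrum.mem_iff, Matrix.isUnit_iff_isUnit_det, isUnit_iff_ne_zero, not_not]
  have h1 : ∀ᶠ M in 𝓝 M₀, ∀ z ∈ K, (algebraMap ℂ (Matrix V V ℂ) z - M).det ≠ 0 := by
    refine hK.eventually_forall_of_forall_eventually fun z hz => ?_
    refine (hcont.tendsto (M₀, z)).eventually_ne ?_
    intro h0
    exact h z ((hspec _ _).2 h0) hz.2
  have h2 : ∀ᶠ M in 𝓝 M₀, ‖M‖ < ‖M₀‖ + 1 :=
    (continuous_norm.tendsto M₀).eventually (gt_mem_nhds (by linarith))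
  filter_upwards [h1, h2] with M hM1 hM2 z hz hz0
  refine hM1 z ⟨?_, hz0⟩ ((hspec _ _).1 hz)
  rw [mem_closedBall_zero_iff]
  exact (spectrum.norm_le_norm_mul_of_mem hz).trans
    (mul_le_mul_of_nonneg_right hM2.le (norm_nonneg _))

end Persistence

/-! ### Robust failure of induction -/

section Robust

namespace IONetwork

variable {V : Type*} [Fintype V] [DecidableEq V] {G : IONetwork V}

/-- The entries of the Jacobian as a linear function of the derivative. -/
noncomputable def jacobianEntries :
    ((V → ℝ) × ℝ →L[ℝ] (V → ℝ)) →L[ℝ] (V → V → ℝ) :=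
  ContinuousLinearMap.pi fun j => ContinuousLinearMap.pi fun l =>
    (ContinuousLinearMap.proj j).comp
      (ContinuousLinearMap.apply ℝ (V → ℝ) ((Pi.single l 1, 0) : (V → ℝ) × ℝ))

open Classical in
/-- The determinant of the homeostasis block as a function of the derivative of the family. -/
noncomputable def BackboneNode.detOfDeriv (L : G.BackboneNode)
    (A : (V → ℝ) × ℝ →L[ℝ] (V → ℝ)) : ℝ :=
  (homeostasisMatrix (Matrix.of (jacobianEntries A)) L.structural L.prev L.next).det

theorem BackboneNode.contDiff_detOfDeriv (L : G.BackboneNode) : ContDiff ℝ ∞ L.detOfDeriv := by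
  classical
  unfold BackboneNode.detOfDeriv
  simp only [Matrix.det_apply', homeostasisMatrix, Matrix.of_apply]
  have h : ∀ j l : V, ContDiff ℝ ∞ fun A => jacobianEntries A j l := fun j l =>
    contDiff_pi.1 (contDiff_pi.1 (jacobianEntries (V := V)).contDiff j) l
  exact ContDiff.sum fun σ _ => contDiff_const.mul (contDiff_prod fun i _ => h _ _)

theorem BackboneNode.hasFDerivAt_blockDet (L : G.BackboneNode) {f : (V → ℝ) × ℝ → (V → ℝ)}
    (hf : ContDiff ℝ ∞ f) (p : (V → ℝ) × ℝ) : HasFDerivAt (L.blockDet f)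
      ((fderiv ℝ L.detOfDeriv (fderiv ℝ f p)).comp (fderiv ℝ (fderiv ℝ f) p)) p := by
  have h1 : HasFDerivAt L.detOfDeriv (fderiv ℝ L.detOfDeriv (fderiv ℝ f p)) (fderiv ℝ f p) :=
    (L.contDiff_detOfDeriv.differentiable (by simp) _).hasFDerivAt
  have h2 : ContDiff ℝ ∞ (fderiv ℝ f) := (contDiff_infty_iff_fderiv.1 hf).2
  exact h1.comp p (h2.differentiable (by simp) p).hasFDerivAt

/-- Through an equilibrium with invertible Jacobian there is a smooth branch of equilibria. -/
theorem exists_branch {f : (V → ℝ) × ℝ → (V → ℝ)} (hf : ContDiff ℝ ∞ f) {X₀ : V → ℝ} {I₀ : ℝ}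
    (h₀ : f (X₀, I₀) = 0) (hdet : (jacobian f (X₀, I₀)).det ≠ 0) :
    ∃ X : ℝ → V → ℝ, X I₀ = X₀ ∧ ContDiffAt ℝ ∞ X I₀ ∧ ∀ᶠ I in 𝓝 I₀, f (X I, I) = 0 := by
  let Ψ : (V → ℝ) × ℝ → (V → ℝ) × ℝ := fun p => (f p, p.2)
  have hΨ : ContDiffAt ℝ ∞ Ψ (X₀, I₀) := (hf.prodMk contDiff_snd).contDiffAt
  have hΨ' : HasFDerivAt Ψ ((fderiv ℝ f (X₀, I₀)).prod (ContinuousLinearMap.snd ℝ (V → ℝ) ℝ))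
      (X₀, I₀) :=
    (hf.differentiable (by simp) _).hasFDerivAt.prodMk hasFDerivAt_snd
  obtain ⟨B, hB⟩ := exists_continuousLinearEquiv_of_injective
    ((fderiv ℝ f (X₀, I₀)).prod (ContinuousLinearMap.snd ℝ (V → ℝ) ℝ)) (by
      rintro ⟨y, c⟩ hyc
      have hc : c = 0 := congrArg Prod.snd hyc
      have hy : fderiv ℝ f (X₀, I₀) (y, c) = 0 := congrArg Prod.fst hyc
      rw [fderiv_apply_eq, hc, zero_smul, add_zero] at hy
      rw [hc, Matrix.eq_zero_of_mulVec_eq_zero hdet hy]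
      rfl)
  rw [← hB] at hΨ'
  have hn : (∞ : WithTop ℕ∞) ≠ 0 := by simp
  have hval : Ψ (X₀, I₀) = (0, I₀) := by simp [Ψ, h₀]
  have h1 := hΨ.localInverse_apply_image hΨ' hn
  have h2 := hΨ.to_localInverse hΨ' hn
  have h3 : ∀ᶠ y in 𝓝 (Ψ (X₀, I₀)), Ψ (hΨ.localInverse hΨ' hn y) = y :=
    (hΨ.hasStrictFDerivAt' hΨ' hn).eventually_right_inverse
  rw [hval] at h1 h2 h3
  have hline : ContDiff ℝ ∞ fun I : ℝ => ((0 : V → ℝ), I) := contDiff_const.prodMk contDiff_id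
  refine ⟨fun I => (hΨ.localInverse hΨ' hn (0, I)).1, congrArg Prod.fst h1, ?_, ?_⟩
  · exact contDiff_fst.contDiffAt.comp I₀ (h2.comp I₀ hline.contDiffAt)
  · have h4 := (hline.continuous.tendsto I₀).eventually h3
    filter_upwards [h4] with I hI
    have h5 : (hΨ.localInverse hΨ' hn (0, I)).2 = I := congrArg Prod.snd hI
    have h6 : f (hΨ.localInverse hΨ' hn (0, I)) = 0 := congrArg Prod.fst hI
    have h7 : ((hΨ.localInverse hΨ' hn (0, I)).1, I) = hΨ.localInverse hΨ' hn (0, I) :=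
      Prod.ext rfl h5.symm
    rw [h7, h6]

/-- If the equilibria with singular homeostasis block are cut out transversally at a hyperbolic
equilibrium, and the node `κ` responds there to the input, then nearby families have such equilibria
too. Since admissible families form a Baire space, the subnetwork does not induce `κ`. -/
theorem BackboneNode.not_inducesNode_of_regular (L : G.BackboneNode) {κ : V}
    (f₀ : G.AdmissibleFamily) (p₀ : (V → ℝ) × ℝ) (h₀ : f₀.1 p₀ = 0)
    (hhyp : ∀ z ∈ spectrum ℂ ((jacobian f₀.1 p₀).map (algebraMap ℝ ℂ)), z.re ≠ 0)
    (hB : L.blockDet f₀.1 p₀ = 0)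
    (hreg : ∀ y c, fderiv ℝ f₀.1 p₀ (y, c) = 0 →
      fderiv ℝ (L.blockDet f₀.1) p₀ (y, c) = 0 → y = 0 ∧ c = 0)
    {x : V → ℝ} (hx : jacobian f₀.1 p₀ *ᵥ x = - fderiv ℝ f₀.1 p₀ (0, 1)) (hxκ : x κ ≠ 0)
    (ho : G.output ∉ G.before L.next) : ¬ L.InducesNode κ := by
  intro hind
  have hJcont : Continuous fun q : G.AdmissibleFamily × ((V → ℝ) × ℝ) => jacobian q.1.1 q.2 :=
    continuous_matrix fun j l => ((continuous_apply l).comp (continuous_apply j)).comp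
      (jacobianEntries.continuous.comp AdmissibleFamily.continuous_fderiv)
  have hdet : (jacobian f₀.1 p₀).det ≠ 0 :=
    IsHyperbolicEquilibrium.det_ne_zero (X₀ := p₀.1) (I₀ := p₀.2) ⟨h₀, hhyp⟩
  -- the open conditions on the family and the point
  have hopen1 : ∀ᶠ q in 𝓝 (f₀, p₀), ∀ z ∈ spectrum ℂ ((jacobian q.1.1 q.2).map (algebraMap ℝ ℂ)),
      z.re ≠ 0 := by
    have hc : Continuous fun q : G.AdmissibleFamily × ((V → ℝ) × ℝ) =>
        (jacobian q.1.1 q.2).map (algebraMap ℝ ℂ) :=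
      hJcont.matrix_map Complex.continuous_ofReal
    exact (hc.tendsto (f₀, p₀)).eventually (eventually_spectrum_re_ne_zero hhyp)
  have hresp : Continuous fun q : G.AdmissibleFamily × ((V → ℝ) × ℝ) =>
      ((jacobian q.1.1 q.2).adjugate *ᵥ fderiv ℝ q.1.1 q.2 (0, 1)) κ :=
    (continuous_apply κ).comp (hJcont.matrix_adjugate.matrix_mulVec
      (AdmissibleFamily.continuous_fderiv.clm_apply continuous_const))
  have hopen2 : ∀ᶠ q in 𝓝 (f₀, p₀),
      ((jacobian q.1.1 q.2).adjugate *ᵥ fderiv ℝ q.1.1 q.2 (0, 1)) κ ≠ 0 := by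
    refine (hresp.tendsto (f₀, p₀)).eventually_ne ?_
    have h1 : (jacobian f₀.1 p₀).adjugate *ᵥ fderiv ℝ f₀.1 p₀ (0, 1) =
        -((jacobian f₀.1 p₀).det • x) := by
      rw [← neg_eq_iff_eq_neg, ← Matrix.mulVec_neg, ← hx, Matrix.mulVec_mulVec,
        Matrix.adjugate_mul, Matrix.smul_mulVec, Matrix.one_mulVec]
    simp only [h1]
    simp [hdet, hxκ]
  obtain ⟨P, hP, W, hW, hPW⟩ := eventually_prod_iff.1 (nhds_prod_eq (x := f₀) (y := p₀) ▸
    (hopen1.and hopen2))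
  -- persistence of the transversal zero
  let F : G.AdmissibleFamily → (V → ℝ) × ℝ → (V → ℝ) × ℝ := fun f p => (f.1 p, L.blockDet f.1 p)
  let F' : G.AdmissibleFamily → (V → ℝ) × ℝ → ((V → ℝ) × ℝ →L[ℝ] (V → ℝ) × ℝ) := fun f p =>
    (fderiv ℝ f.1 p).prod ((fderiv ℝ L.detOfDeriv (fderiv ℝ f.1 p)).comp
      (fderiv ℝ (fderiv ℝ f.1) p))
  have hF : ∀ f p, HasFDerivAt (F f) (F' f p) p := fun f p =>
    (f.2.differentiableAt.hasFDerivAt).prodMk (L.hasFDerivAt_blockDet f.2.1 p)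
  have hF' : Continuous fun q : G.AdmissibleFamily × ((V → ℝ) × ℝ) => F' q.1 q.2 := by
    have h1 : Continuous (fderiv ℝ L.detOfDeriv) := L.contDiff_detOfDeriv.continuous_fderiv (by simp)
    exact (ContinuousLinearMap.prodₗᵢ ℝ).continuous.comp
      (AdmissibleFamily.continuous_fderiv.prodMk
        ((h1.comp AdmissibleFamily.continuous_fderiv).clm_comp
          AdmissibleFamily.continuous_fderiv_fderiv))
  have hFc : Continuous fun f => F f p₀ := by
    have hpt : Continuous fun f : G.AdmissibleFamily => (f, p₀) := by fun_prop
    refine (AdmissibleFamily.continuous_eval.comp hpt).prodMk ?_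
    exact L.contDiff_detOfDeriv.continuous.comp (AdmissibleFamily.continuous_fderiv.comp hpt)
  obtain ⟨A, hA⟩ := exists_continuousLinearEquiv_of_injective (F' f₀ p₀) (by
    rintro ⟨y, c⟩ hyc
    obtain ⟨rfl, rfl⟩ := hreg y c (congrArg Prod.fst hyc) (by
      rw [(L.hasFDerivAt_blockDet f₀.2.1 p₀).fderiv]
      exact congrArg Prod.snd hyc)
    rfl)
  have hzero := eventually_exists_zero hF hF'.continuousAt hFc.continuousAt
    (show F f₀ p₀ = 0 by simp [F, h₀, hB]) A hA.symm hW
  -- a generic family close to `f₀`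
  obtain ⟨f, hf, hfP, p, hpW, hp0⟩ :=
    (dense_of_mem_residual hind).inter_nhds_nonempty (hP.and hzero)
  obtain ⟨hh, hr⟩ := hPW hfP hpW
  have hfp : f.1 p = 0 := congrArg Prod.fst hp0
  have hBp : L.blockDet f.1 p = 0 := congrArg Prod.snd hp0
  have heq : IsHyperbolicEquilibrium f.1 p.1 p.2 := ⟨hfp, hh⟩
  have hdetp := heq.det_ne_zero
  obtain ⟨X, hX0, hX, hX1⟩ := exists_branch f.2.1 hfp hdetp
  have hout : IsHomeostatic f.1 p.1 p.2 G.output := by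
    refine ⟨X, hX0, hX, hX1, ?_⟩
    rw [deriv_component hX]
    refine L.eq_zero_of_blockDet_eq_zero (fun j l h1 h2 => f.2.jacobian_eq_zero h1 h2)
      hdetp hBp (fun k hk => ?_) ho
    have h1 := jacobian_mulVec_deriv f.2 hX hX1
    rw [hX0] at h1
    rw [h1, Pi.neg_apply, f.2.fderiv_parameter hk, neg_zero]
  obtain ⟨Y, hY0, hY, hY1, hY2⟩ := hf p.1 p.2 heq hout hBp
  have h1 := jacobian_mulVec_deriv f.2 hY hY1
  rw [deriv_component hY] at hY2
  rw [hY0] at h1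
  apply hr
  have h2 : fderiv ℝ f.1 p (0, 1) = -(jacobian f.1 p *ᵥ deriv Y p.2) := by
    rw [show jacobian f.1 p = jacobian f.1 (p.1, p.2) from rfl, h1, neg_neg]
  rw [h2, Matrix.mulVec_neg, Matrix.mulVec_mulVec, Matrix.adjugate_mul, Matrix.smul_mulVec,
    Matrix.one_mulVec]
  simp [hY2]

end IONetwork

end Robust

/-! ### A family that breaks the path between two super-simple nodes -/

section Example

/-- `u` is the node immediately before `v` in the list `S`. -/
def Link {V : Type*} (S : List V) (u v : V) : Prop := ∃ a b, S = a ++ u :: v :: b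

section Chain

variable {V : Type*} {S : List V} {s u v w : V}

theorem Link.left_unique (hn : S.Nodup) (h₁ : Link S u w) (h₂ : Link S v w) : u = v := by
  obtain ⟨a, b, rfl⟩ := h₁
  obtain ⟨a', b', h⟩ := h₂
  have hn' := hn
  rw [h] at hn'
  have h1 : (a ++ [u]) ++ w :: b = (a' ++ [v]) ++ w :: b' := by simpa using h
  have h2 := (List.append_cons_inj_of_notMem (x₁ := a ++ [u]) (x₂ := a' ++ [v]) (z₁ := b)
    (a₁ := w) (a₂ := w) (by grind) (by grind)).1 h1
  simpa using congrArg List.getLast? h2.1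

theorem Link.ne (hn : S.Nodup) (h : Link S u v) : u ≠ v := by
  obtain ⟨a, b, rfl⟩ := h
  grind

theorem Link.right_mem (h : Link S u v) : v ∈ S := by
  obtain ⟨a, b, rfl⟩ := h
  simp

theorem Link.rel {r : V → V → Prop} (hS : S.IsChain r) (h : Link S u v) : r u v := by
  obtain ⟨a, b, h⟩ := h
  exact List.isChain_iff_forall_rel_of_append_cons_cons.1 hS h

theorem not_link_head {S : List V} (hn : (v :: S).Nodup) : ¬ Link (v :: S) u v := by
  rintro ⟨a, b, h⟩
  cases a with
  | nil => grind
  | cons c a => grind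

variable [Fintype V] [DecidableEq V]

open Classical in
/-- The Jacobian of a feedforward chain along the list `S`, with self-coupling `-1` at every node
and coupling `1` along the list, except for the coupling `x` out of the node `s`. -/
noncomputable def chainMatrix {R : Type*} [CommRing R] (S : List V) (s : V) (x : R) :
    Matrix V V R :=
  Matrix.of fun j l => (if l = j then -1 else 0) +
    (if Link S l j then (if l = s then x else 1) else 0)

variable {R : Type*} [CommRing R] {x : R} {y : V → R}

theorem chainMatrix_mulVec_of_link (hn : S.Nodup) (h : Link S u v) :
    (chainMatrix S s x *ᵥ y) v = -y v + (if u = s then x else 1) * y u := by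
  classical
  simp only [chainMatrix, Matrix.mulVec, dotProduct, Matrix.of_apply, add_mul,
    Finset.sum_add_distrib]
  congr 1
  · simp
  · rw [Finset.sum_eq_single u]
    · simp [h]
    · intro w _ hw
      rw [if_neg (fun h' => hw (h'.left_unique hn h)), zero_mul]
    · simp

theorem chainMatrix_mulVec_of_not_link (h : ∀ u, ¬ Link S u v) :
    (chainMatrix S s x *ᵥ y) v = -y v := by
  classical
  simp [chainMatrix, Matrix.mulVec, dotProduct, h]

/-- A chain has the eigenvalue `-1` only. -/
theorem eq_neg_one_of_mem_spectrum_chainMatrix {K : Type*} [Field K] {x z : K} (hn : S.Nodup)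
    (hz : z ∈ spectrum K (chainMatrix S s x)) : z = -1 := by
  by_contra hz1
  rw [spectrum.mem_iff, Matrix.isUnit_iff_isUnit_det, isUnit_iff_ne_zero, not_not,
    ← Matrix.exists_mulVec_eq_zero_iff] at hz
  obtain ⟨y, hy0, hy⟩ := hz
  have hrow : ∀ v, (chainMatrix S s x *ᵥ y) v = z * y v := by
    intro v
    have := congrFun hy v
    rw [Matrix.sub_mulVec, Algebra.algebraMap_eq_smul_one, Matrix.smul_mulVec,
      Matrix.one_mulVec] at this
    simpa [sub_eq_zero, eq_comm] using this
  have hz2 : z + 1 ≠ 0 := fun h => hz1 (eq_neg_of_add_eq_zero_left h)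
  have hstart : ∀ v, (∀ u, ¬ Link S u v) → y v = 0 := by
    intro v hv
    have h1 := hrow v
    rw [chainMatrix_mulVec_of_not_link hv] at h1
    have : (z + 1) * y v = 0 := by linear_combination -h1
    exact (mul_eq_zero.1 this).resolve_left hz2
  have hlist : ∀ m v n, S = m ++ v :: n → y v = 0 := by
    intro m
    induction m using List.reverseRecOn with
    | nil =>
      rintro v n rfl
      exact hstart v fun u => not_link_head hn
    | append_singleton m u ih =>
      intro v n h
      have hu : y u = 0 := ih u (v :: n) (by simpa using h)
      have h1 := hrow v
      rw [chainMatrix_mulVec_of_link hn ⟨m, n, by simpa using h⟩, hu, mul_zero, add_zero] at h1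
      have : (z + 1) * y v = 0 := by linear_combination -h1
      exact (mul_eq_zero.1 this).resolve_left hz2
  apply hy0
  ext v
  by_cases hv : v ∈ S
  · obtain ⟨m, n, h⟩ := List.append_of_mem hv
    exact hlist m v n h
  · exact hstart v fun u h => hv h.right_mem

end Chain

namespace IONetwork

variable {V : Type*} [Fintype V] [DecidableEq V] (G : IONetwork V)

open Classical in
/-- The influence of the node `l` on the node `j`: linear along the list `S`, but quadratic out of
the node `s`. Admissibility demands that every other arrow acts somewhere; these arrows act only
where the value of their source exceeds `1`, so that they play no role near the origin. -/
noncomputable def coupling (S : List V) (s j l : V) (x : ℝ) : ℝ :=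
  if Link S l j then (if l = s then x ^ 2 / 2 else x)
  else if l ≠ j ∧ G.graph.Adj l j then Real.smoothTransition (x - 1) else 0

/-- A family that is near the origin a feedforward chain along the list `S`, where the coupling out
of the node `s` changes its sign. -/
noncomputable def chainFamily (S : List V) (s : V) (p : (V → ℝ) × ℝ) (j : V) : ℝ :=
  -p.1 j + (if j = G.input then p.2 else 0) + ∑ l, G.coupling S s j l (p.1 l)

variable {G} {S : List V} {s : V}

theorem contDiff_coupling (j l : V) : ContDiff ℝ ∞ (G.coupling S s j l) := by
  unfold coupling
  split_ifs
  · fun_prop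
  · fun_prop
  · exact Real.smoothTransition.contDiff.comp (contDiff_id.sub contDiff_const)
  · exact contDiff_const

theorem contDiff_chainFamily : ContDiff ℝ ∞ (G.chainFamily S s) := by
  refine contDiff_pi.2 fun j => ?_
  have h1 : ∀ l : V, ContDiff ℝ ∞ fun p : (V → ℝ) × ℝ => p.1 l := fun l =>
    (contDiff_apply ℝ ℝ l).comp contDiff_fst
  refine ContDiff.add ((h1 j).neg.add ?_)
    (ContDiff.sum fun l _ => (contDiff_coupling j l).comp (h1 l))
  split_ifs
  · exact contDiff_snd
  · exact contDiff_const

theorem fderiv_chainFamily (p : (V → ℝ) × ℝ) (y : V → ℝ) (c : ℝ) (j : V) :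
    fderiv ℝ (G.chainFamily S s) p (y, c) j =
      -y j + (if j = G.input then c else 0) + ∑ l, deriv (G.coupling S s j l) (p.1 l) * y l := by
  -- differentiate along the line through `p` in the direction `(y, c)`
  have h1 : HasDerivAt (fun t : ℝ => p + t • (y, c)) (y, c) 0 := by
    simpa using ((hasDerivAt_id (0 : ℝ)).smul_const (y, c)).const_add p
  have h2 : HasDerivAt (fun t : ℝ => G.chainFamily S s (p + t • (y, c)))
      (fderiv ℝ (G.chainFamily S s) p (y, c)) 0 := by
    have := (contDiff_chainFamily (G := G) (S := S) (s := s)).differentiable (by simp)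
      (p + (0 : ℝ) • (y, c))
    have h3 := HasFDerivAt.comp_hasDerivAt (0 : ℝ) this.hasFDerivAt h1
    rw [zero_smul, add_zero] at h3
    exact h3
  refine (hasDerivAt_pi.1 h2 j).unique ?_
  have h4 : ∀ l : V, HasDerivAt (fun t : ℝ => p.1 l + t * y l) (y l) 0 := fun l => by
    simpa using ((hasDerivAt_id (0 : ℝ)).mul_const (y l)).const_add (p.1 l)
  have h5 : ∀ l : V, HasDerivAt (fun t : ℝ => G.coupling S s j l (p.1 l + t * y l))
      (deriv (G.coupling S s j l) (p.1 l) * y l) 0 := fun l => by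
    have h6 : HasDerivAt (G.coupling S s j l) (deriv (G.coupling S s j l) (p.1 l))
        (p.1 l + 0 * y l) := by
      rw [zero_mul, add_zero]
      exact ((contDiff_coupling j l).differentiable (by simp) _).hasDerivAt
    exact h6.comp (0 : ℝ) (h4 l)
  have h6 : HasDerivAt (fun t : ℝ => if j = G.input then p.2 + t * c else 0)
      (if j = G.input then c else 0) 0 := by
    split_ifs
    · simpa using ((hasDerivAt_id (0 : ℝ)).mul_const c).const_add p.2
    · exact hasDerivAt_const _ _
  exact ((h4 j).neg.add h6).add (HasDerivAt.fun_sum fun l _ => h5 l)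

theorem jacobian_chainFamily (p : (V → ℝ) × ℝ) (j l : V) :
    jacobian (G.chainFamily S s) p j l =
      (if l = j then -1 else 0) + deriv (G.coupling S s j l) (p.1 l) := by
  simp only [jacobian, Matrix.of_apply, fderiv_chainFamily]
  simp only [Pi.single_apply, ite_self, add_zero, mul_ite, mul_one, mul_zero,
    Finset.sum_ite_eq', Finset.mem_univ, if_true]
  congr 1
  by_cases h : j = l
  · simp [h]
  · simp [h, Ne.symm h]

theorem deriv_coupling_of_link {j l : V} (h : Link S l j) (x : ℝ) :
    deriv (G.coupling S s j l) x = if l = s then x else 1 := by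
  have h0 : G.coupling S s j l = fun x => if l = s then x ^ 2 / 2 else x := by
    ext x
    simp [coupling, h]
  rw [h0]
  split_ifs
  · simp
  · simp

theorem deriv_coupling_of_lt_one {j l : V} (h : ¬ Link S l j) {x : ℝ} (hx : x < 1) :
    deriv (G.coupling S s j l) x = 0 := by
  have h1 : G.coupling S s j l =ᶠ[𝓝 x] fun _ => 0 := by
    filter_upwards [gt_mem_nhds hx] with z hz
    have : Real.smoothTransition (z - 1) = 0 := Real.smoothTransition.zero_of_nonpos (by linarith)
    simp [coupling, h, this]
  rw [h1.deriv_eq]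
  simp

theorem exists_deriv_coupling_ne_zero {j l : V} (hlj : l ≠ j)
    (h : G.graph.Adj l j) : ∃ x, deriv (G.coupling S s j l) x ≠ 0 := by
  by_cases hl : Link S l j
  · refine ⟨1, ?_⟩
    rw [deriv_coupling_of_link hl]
    simp
  · by_contra! h0
    have h1 := is_const_of_deriv_eq_zero ((contDiff_coupling (G := G) (S := S) (s := s)
      j l).differentiable (by simp)) h0 0 2
    have h2 : Real.smoothTransition ((0 : ℝ) - 1) = 0 :=
      Real.smoothTransition.zero_of_nonpos (by norm_num)
    have h3 : Real.smoothTransition ((2 : ℝ) - 1) = 1 :=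
      Real.smoothTransition.one_of_one_le (by norm_num)
    simp only [coupling, if_neg hl, if_pos (And.intro hlj h), h2, h3] at h1
    norm_num at h1

theorem isAdmissible_chainFamily (hS : G.IsIOPath S) : G.IsAdmissible (G.chainFamily S s) := by
  have hn : S.Nodup := IsPath.nodup hS
  refine ⟨contDiff_chainFamily, fun j l => ⟨fun h hjl => ?_, fun h p => ?_⟩,
    fun j hj X I I' => by simp [chainFamily, hj]⟩
  · by_cases hlj : l = j
    · subst hlj
      have h1 := h 0
      rw [jacobian_chainFamily, deriv_coupling_of_lt_one (fun h => h.ne hn rfl) (by simp)] at h1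
      simp at h1
    · obtain ⟨x, hx⟩ := exists_deriv_coupling_ne_zero (S := S) (s := s) hlj (hjl.resolve_left hlj)
      have h1 := h (fun _ => x, 0)
      rw [jacobian_chainFamily, if_neg hlj, zero_add] at h1
      exact hx h1
  · rw [not_or] at h
    have h1 : ¬ Link S l j := fun h2 => h.2 (h2.rel hS.2.2.2)
    have h2 : G.coupling S s j l = fun _ => 0 := by
      ext x
      simp [coupling, h1, h.2]
    rw [jacobian_chainFamily, if_neg h.1, h2]
    simp

theorem jacobian_chainFamily_of_lt_one {p : (V → ℝ) × ℝ} (hp : ∀ v, p.1 v < 1) :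
    jacobian (G.chainFamily S s) p = chainMatrix S s (p.1 s) := by
  ext j l
  rw [jacobian_chainFamily]
  simp only [chainMatrix, Matrix.of_apply]
  congr 1
  by_cases h : Link S l j
  · rw [deriv_coupling_of_link h, if_pos h]
    split_ifs with h1
    · rw [h1]
    · rfl
  · rw [deriv_coupling_of_lt_one h (hp l), if_neg h]

theorem fderiv_chainFamily_parameter (p : (V → ℝ) × ℝ) :
    fderiv ℝ (G.chainFamily S s) p (0, 1) = Pi.single G.input 1 := by
  ext j
  rw [fderiv_chainFamily]
  simp [Pi.single_apply]

theorem chainFamily_zero : G.chainFamily S s 0 = 0 := by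
  ext j
  have h2 : Real.smoothTransition (-1 : ℝ) = 0 :=
    Real.smoothTransition.zero_of_nonpos (by norm_num)
  simp [chainFamily, coupling, h2]

namespace BackboneNode

variable (L : G.BackboneNode) {l₁ l₂ l₃ : List V}

open Classical in
/-- The homeostasis block of the chain vanishes to first order with the broken coupling. -/
theorem det_homeostasisMatrix_chainMatrix (x : ℝ) :
    (homeostasisMatrix (chainMatrix S L.prev x) L.structural L.prev L.next).det =
      x * (homeostasisMatrix (chainMatrix S L.prev 1) L.structural L.prev L.next).det := by
  have hb : L.next ∈ L.structural ∧ L.next ≠ L.prev := by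
    simp [structural_eq, prev_ne_next.symm]
  have h1 : homeostasisMatrix (chainMatrix S L.prev x) L.structural L.prev L.next =
      homeostasisMatrix (chainMatrix S L.prev 1) L.structural L.prev L.next *
        Matrix.diagonal (fun c => if c = ⟨L.next, hb⟩ then x else 1) := by
    ext ⟨r, hr⟩ ⟨c, hc⟩
    rw [Matrix.mul_diagonal]
    simp only [homeostasisMatrix, chainMatrix, Matrix.of_apply, Subtype.mk.injEq]
    by_cases h : c = L.next
    · simp [h, hr.2.symm]
    · simp [h, hc.2]
  rw [h1, Matrix.det_mul, Matrix.det_diagonal, mul_comm]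
  simp

open Classical in
theorem det_homeostasisMatrix_chainMatrix_ne_zero
    (hS : G.IsIOPath (l₁ ++ L.prev :: (l₂ ++ L.next :: l₃))) (hl₂ : ∀ x ∈ l₂, x ∈ L.middle) :
    (homeostasisMatrix (chainMatrix (l₁ ++ L.prev :: (l₂ ++ L.next :: l₃)) L.prev (1 : ℝ))
      L.structural L.prev L.next).det ≠ 0 := by
  have hn := IsPath.nodup hS
  rw [Ne, det_homeostasisMatrix_eq_zero_iff _ prev_ne_next (by simp [structural_eq])
    (by simp [structural_eq])]
  rintro ⟨y, hy0, hsupp, hrow⟩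
  have hnext : y L.next = 0 := by
    by_contra h
    exact (hsupp _ h).2 rfl
  have hstep : ∀ u v, Link (l₁ ++ L.prev :: (l₂ ++ L.next :: l₃)) u v → v ∈ l₂ ∨ v = L.next →
      y v = 0 → y u = 0 := by
    intro u v huv hv hyv
    have h1 := hrow v (by
      rw [structural_eq]
      exact hv.elim (fun h => .inl (.inr (hl₂ v h))) fun h => .inr h) (by
      rintro rfl
      rcases hv with h | h
      · exact prev_not_mem_middle (hl₂ _ h)
      · exact prev_ne_next h)
    rw [chainMatrix_mulVec_of_link hn huv, hyv] at h1
    simpa using h1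
  have hlist : ∀ n m v, L.prev :: l₂ = m ++ v :: n → y v = 0 := by
    intro n
    induction n with
    | nil =>
      intro m v h
      exact hstep v L.next ⟨l₁ ++ m, l₃, by
        rw [← List.cons_append, h]; simp⟩ (.inr rfl) hnext
    | cons w n ih =>
      intro m v h
      refine hstep v w ⟨l₁ ++ m, n ++ L.next :: l₃, by rw [← List.cons_append, h]; simp⟩ (.inl ?_)
        (ih (m ++ [v]) w (by simpa using h))
      cases m with
      | nil =>
        simp only [List.nil_append, List.cons.injEq] at h
        simp [h.2]
      | cons a m =>
        simp only [List.cons_append, List.cons.injEq] at h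
        simp [h.2]
  apply hy0
  ext v
  by_contra hv
  have hv1 := hsupp v hv
  have hvl : v ∉ L.prev :: l₂ := by
    intro h
    obtain ⟨m, n, h⟩ := List.append_of_mem h
    exact hv (hlist n m v h)
  have hvp : v ≠ L.prev := fun h => hvl (by simp [h])
  have hvm : v ∈ L.middle := by
    have := hv1.1
    rw [structural_eq] at this
    simpa [hvp, hv1.2] using this
  have h1 := hrow v hv1.1 hvp
  rw [chainMatrix_mulVec_of_not_link] at h1
  · exact hv (by simpa using h1)
  · intro u hu
    have h2 := hu.right_mem
    have hS' : G.IsIOPath ((l₁ ++ L.prev :: l₂) ++ L.next :: l₃) := by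
      rwa [List.append_assoc, List.cons_append]
    have h3 : v ∉ l₁ := fun h =>
      L.prev_superSimple.not_mem_after (mem_before_of_split hS h) hvm.2
    have h4 : v ∉ l₃ := fun h =>
      L.next_superSimple.not_mem_after hvm.1 (mem_after_of_split hS' h)
    simp only [List.mem_append, List.mem_cons] at h2 hvl
    have := hv1.2
    tauto

/-- The response of the chain to the input dies out after the broken coupling. -/
theorem chainMatrix_mulVec_response
    (hS : G.IsIOPath (l₁ ++ L.prev :: (l₂ ++ L.next :: l₃))) :
    chainMatrix (l₁ ++ L.prev :: (l₂ ++ L.next :: l₃)) L.prev (0 : ℝ) *ᵥ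
      (fun v => if v ∈ l₁ ∨ v = L.prev then 1 else 0) = -Pi.single G.input 1 := by
  have hn := IsPath.nodup hS
  have hhead := hS.1
  ext v
  by_cases hv : v = G.input
  · rw [chainMatrix_mulVec_of_not_link]
    · have : v ∈ l₁ ∨ v = L.prev := by
        cases l₁ with
        | nil => simp at hhead; simp [hv, hhead]
        | cons a l => simp at hhead; simp [hv, hhead]
      simp only [this, if_true]
      simp [hv]
    · intro u
      cases l₁ with
      | nil =>
        simp only [List.nil_append] at hhead hn ⊢
        simp at hhead
        rw [hv, ← hhead]
        exact not_link_head hn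
      | cons a l =>
        simp only [List.cons_append] at hhead hn ⊢
        simp at hhead
        rw [hv, ← hhead]
        exact not_link_head hn
  · simp only [Pi.neg_apply, Pi.single_apply, hv, if_false, neg_zero]
    by_cases hlink : ∃ u, Link (l₁ ++ L.prev :: (l₂ ++ L.next :: l₃)) u v
    · obtain ⟨u, hu⟩ := hlink
      rw [chainMatrix_mulVec_of_link hn hu]
      by_cases hup : u = L.prev
      · obtain ⟨a, b, h⟩ := hu
        have h1 : v ∉ l₁ ∧ v ≠ L.prev := by
          subst hup
          have h2 := (List.append_cons_inj_of_notMem (x₁ := l₁) (z₁ := l₂ ++ L.next :: l₃)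
            (a₁ := L.prev) (a₂ := L.prev) (by grind) (by grind)).1 h
          grind
        simp [hup, h1]
      · have key : (v ∈ l₁ ∨ v = L.prev) ↔ (u ∈ l₁ ∨ u = L.prev) := by
          obtain ⟨a, b, h⟩ := hu
          rcases List.append_eq_append_iff.1 h with ⟨c, h1, h2⟩ | ⟨c, h1, h2⟩
          · cases c with
            | nil => grind
            | cons d c => grind
          · cases c with
            | nil => grind
            | cons d c => cases c <;> grind
        simp [key, hup]
    · rw [chainMatrix_mulVec_of_not_link (not_exists.1 hlink)]
      have : ¬ (v ∈ l₁ ∨ v = L.prev) := by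
        intro h
        apply hlink
        have hvS : v ∈ l₁ ++ [L.prev] := by simpa using h
        obtain ⟨m, n, hmn⟩ := List.append_of_mem hvS
        rcases List.eq_nil_or_concat m with rfl | ⟨m', u, rfl⟩
        · have h5 : (l₁ ++ L.prev :: (l₂ ++ L.next :: l₃)).head? = some v := by
            have : l₁ ++ L.prev :: (l₂ ++ L.next :: l₃) = v :: (n ++ (l₂ ++ L.next :: l₃)) := by
              rw [List.append_cons, hmn]; simp
            rw [this]; rfl
          rw [hhead] at h5
          exact absurd (Option.some.inj h5).symm hv
        · exact ⟨u, m', n ++ (l₂ ++ L.next :: l₃), by rw [List.append_cons, hmn]; simp⟩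
      simp [this]

/-- No super-simple node before the backbone node is induced. -/
theorem not_inducesNode_of_mem_before {ρ : V} (hρ : G.IsSuperSimple ρ)
    (hρL : ρ ∈ G.before L.next) : ¬ L.InducesNode ρ := by
  classical
  obtain ⟨S, hS, -⟩ := L.prev_superSimple.1
  obtain ⟨l₁, l₂, l₃, rfl, h₁, h₂, h₃⟩ := L.exists_split hS
  set S := l₁ ++ L.prev :: (l₂ ++ L.next :: l₃) with hSdef
  have hn : S.Nodup := IsPath.nodup hS
  have hρl : ρ ∈ l₁ ∨ ρ = L.prev := by
    have h4 := hρ.2 S hS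
    rw [hSdef] at h4
    simp only [List.mem_append, List.mem_cons] at h4
    rcases h4 with h | h | h | h | h
    · exact .inl h
    · exact .inr h
    · exact absurd hρ (not_superSimple_of_mem_middle (h₂ _ h))
    · exact absurd h hρL.1
    · exact absurd (h₃ _ h) (L.next_superSimple.not_mem_after hρL)
  have hJ0 : jacobian (G.chainFamily S L.prev) 0 = chainMatrix S L.prev 0 :=
    jacobian_chainFamily_of_lt_one (p := 0) fun v => by simp
  have hdet0 : (chainMatrix S L.prev (0 : ℝ)).det ≠ 0 := by
    intro h
    have h0 : (0 : ℝ) ∈ spectrum ℝ (chainMatrix S L.prev (0 : ℝ)) := by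
      rw [spectrum.zero_mem_iff, Matrix.isUnit_iff_isUnit_det, h]
      simp
    simpa using eq_neg_one_of_mem_spectrum_chainMatrix hn h0
  have hresp := L.chainMatrix_mulVec_response hS
  set d := (homeostasisMatrix (chainMatrix S L.prev (1 : ℝ)) L.structural L.prev L.next).det
    with hd
  have hd0 : d ≠ 0 := L.det_homeostasisMatrix_chainMatrix_ne_zero hS h₂
  have hblock : ∀ p : (V → ℝ) × ℝ, (∀ v, p.1 v < 1) →
      L.blockDet (G.chainFamily S L.prev) p = p.1 L.prev * d := by
    intro p hp
    rw [blockDet, jacobian_chainFamily_of_lt_one hp, det_homeostasisMatrix_chainMatrix]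
  have hblock' : HasFDerivAt (L.blockDet (G.chainFamily S L.prev))
      (d • (ContinuousLinearMap.proj L.prev).comp (ContinuousLinearMap.fst ℝ (V → ℝ) ℝ)) 0 := by
    have h1 : HasFDerivAt (fun p : (V → ℝ) × ℝ => d * p.1 L.prev)
        (d • (ContinuousLinearMap.proj L.prev).comp (ContinuousLinearMap.fst ℝ (V → ℝ) ℝ)) 0 :=
      ((ContinuousLinearMap.proj L.prev).comp
        (ContinuousLinearMap.fst ℝ (V → ℝ) ℝ)).hasFDerivAt.const_mul d
    refine h1.congr_of_eventuallyEq ?_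
    have h2 : ∀ᶠ p : (V → ℝ) × ℝ in 𝓝 0, ∀ v, p.1 v < 1 := by
      refine eventually_all.2 fun v => ?_
      have : Continuous fun p : (V → ℝ) × ℝ => p.1 v := by fun_prop
      exact (this.tendsto 0).eventually (gt_mem_nhds (by simp))
    filter_upwards [h2] with p hp
    rw [hblock p hp, mul_comm]
  have hout : G.output ∉ G.before L.next := by
    intro h
    exact L.next_superSimple.not_mem_after h ⟨h.1, .refl⟩
  refine L.not_inducesNode_of_regular ⟨G.chainFamily S L.prev, isAdmissible_chainFamily hS⟩ 0
    chainFamily_zero ?_ ?_ ?_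
    (x := fun v => if v ∈ l₁ ∨ v = L.prev then 1 else 0) ?_ (by simp [hρl]) hout
  · intro z hz
    have h1 : (jacobian (G.chainFamily S L.prev) 0).map (algebraMap ℝ ℂ) =
        chainMatrix S L.prev (0 : ℂ) := by
      rw [hJ0]
      ext j l
      simp only [chainMatrix, Matrix.map_apply, Matrix.of_apply]
      split_ifs <;> simp
    change z ∈ spectrum ℂ ((jacobian (G.chainFamily S L.prev) 0).map (algebraMap ℝ ℂ)) at hz
    rw [h1] at hz
    rw [eq_neg_one_of_mem_spectrum_chainMatrix hn hz]
    simp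
  · change L.blockDet (G.chainFamily S L.prev) 0 = 0
    rw [hblock 0 fun v => by simp]
    simp
  · intro y c h1 h2
    change fderiv ℝ (G.chainFamily S L.prev) 0 (y, c) = 0 at h1
    change fderiv ℝ (L.blockDet (G.chainFamily S L.prev)) 0 (y, c) = 0 at h2
    rw [hblock'.fderiv] at h2
    have hy : y L.prev = 0 := by simpa [hd0] using h2
    rw [fderiv_apply_eq, hJ0, fderiv_chainFamily_parameter] at h1
    have h3 : y - c • (fun v => if v ∈ l₁ ∨ v = L.prev then (1 : ℝ) else 0) = 0 := by
      apply Matrix.eq_zero_of_mulVec_eq_zero hdet0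
      rw [Matrix.mulVec_sub, Matrix.mulVec_smul, hresp, smul_neg, sub_neg_eq_add, h1]
    have hc : c = 0 := by
      have := congrFun h3 L.prev
      simpa [hy] using this
    subst hc
    exact ⟨by simpa using h3, rfl⟩
  · change jacobian (G.chainFamily S L.prev) 0 *ᵥ _ = -fderiv ℝ (G.chainFamily S L.prev) 0 (0, 1)
    rw [hJ0, fderiv_chainFamily_parameter, hresp]

end BackboneNode

end IONetwork

end Example

/-! ### Induction of the pattern nodes -/

theorem theorem2p15 {V : Type*} [Fintype V] [DecidableEq V] (G : IONetwork V) (hG : G.IsCore)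
    (L : G.BackboneNode) (v : G.PatternNode) :
    L.Induces v ↔ G.StrictlyDownstream (.backbone L) v := by
  rw [IONetwork.strictlyDownstream_iff]
  cases v with
  | superSimple ρ hρ =>
    exact ⟨fun h h1 => L.not_inducesNode_of_mem_before hρ h1 h, L.inducesNode_of_not_mem_before⟩
  | backbone M =>
    refine ⟨fun h h1 => L.not_inducesNode_of_mem_before M.prev_superSimple h1 (h _ ?_), ?_⟩
    · simp [IONetwork.BackboneNode.structural_eq]
    · intro h κ hκ
      exact L.inducesNode_of_not_mem_before
        (IONetwork.BackboneNode.not_mem_before_of_mem_structural h hκ)
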